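/- Let $p$ be a prime. Let $T_p^+\subseteq\omega^{<\omega}$ be the tree of all finite sequences $(k_1,\ldots,k_n)$ of natural numbers with $0\le k_i<p^i$ for all $i\le n$ and $k_{i+1}\equiv k_i \bmod p^i$ for all $i<n$. Equip the set $[T_p^+]$ of its infinite paths with the operations $(j_i)_{i>0}+(k_i)_{i>0}=(j_i+k_i \bmod p^i)_{i>0}$ and $-(k_i)_{i>0}=(-k_i\bmod p^i)_{i>0}$ and the constant $0=(0,0,\ldots)$. Write $\mathcal{A}$ for the resulting structure in the signature $\{0,-,+\}$ of additive groups with equality. **Theorem.** (a) $T_p^+$ with this structure is a computable tree presentation of the additive group $\mathbb{Z}_p^+$ of the $p$-adic integers. That is, $T_p^+$ is a computable subtree of $\omega^{<\omega}$ in which every node lies on an infinite path; the operations $0,-,+$ on $[T_p^+]$ are computed by Turing functionals, with the argument paths as oracles; and $\mathcal{A}\cong\mathbb{Z}_p^+$. (b) This presentation is tree-decidable. That is, there is a single Turing functional $\Phi$ such that, for every $n\ge 0$, every first-order formula $\alpha(x_1,\ldots,x_n)$ in this signature, every tuple $(X_1,\ldots,X_n)\in[T_p^+]^n$, and every enumeration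 $D$ of the positive atomic diagram of $(X_1,\ldots,X_n)$, the computation $\Phi^{X_1\oplus\cdots\oplus X_n\oplus D}(\ulcorner\alpha\urcorner)$ halts, with output $1$ if $\mathcal{A}\models\alpha(X_1,\ldots,X_n)$ and with output $0$ if $\mathcal{A}\models\neg\alpha(X_1,\ldots,X_n)$. Here $\ulcorner\cdot\urcorner$ is a standard Gödel numbering. The positive atomic diagram of $(X_1,\ldots,X_n)$ is the set of all Gödel numbers of atomic formulas (equations between terms) $\beta(x_1,\ldots,x_n)$ with $\mathcal{A}\models\beta(X_1,\ldots,X_n)$. An enumeration of a set $A\subseteq\omega$ is a set $D\subseteq\omega$ with $A=\{x : \exists y\ \langle x,y\rangle\in D\}$, where $\langle\cdot,\cdot\rangle$ is a standard computable pairing bijection $\omega^2\to\omega$. -/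

import Mathlib

namespace TreePres

/-! ### Turing functionals -/

/-- Programs with an oracle in `ℕ → ℕ`: the usual indices of partial recursive functions
together with one instruction that queries the oracle. Each program is a Turing functional. -/
inductive OracleCode : Type
  | zero : OracleCode
  | succ : OracleCode
  | left : OracleCode
  | right : OracleCode
  | oracle : OracleCode
  | pair : OracleCode → OracleCode → OracleCode
  | comp : OracleCode → OracleCode → OracleCode
  | prec : OracleCode → OracleCode → OracleCode
  | rfind : OracleCode → OracleCode

/-- `Φ.eval g` is the partial function `Φ^g` computed by the program `Φ` with oracle `g`.
The clauses are those of `Nat.RecursiveIn {g}`. -/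
noncomputable def OracleCode.eval (g : ℕ → ℕ) : OracleCode → ℕ →. ℕ
  | .zero => fun _ => Part.some 0
  | .succ => fun n => Part.some (n + 1)
  | .left => fun n => Part.some n.unpair.1
  | .right => fun n => Part.some n.unpair.2
  | .oracle => fun n => Part.some (g n)
  | .pair a b => fun n => Nat.pair <$> a.eval g n <*> b.eval g n
  | .comp a b => fun n => b.eval g n >>= a.eval g
  | .prec a b => fun m =>
      Nat.rec (a.eval g m.unpair.1)
        (fun y IH => IH >>= fun i => b.eval g (Nat.pair m.unpair.1 (Nat.pair y i))) m.unpair.2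
  | .rfind a => fun m => Nat.rfind fun n => (fun k => decide (k = 0)) <$> a.eval g (Nat.pair m n)

/-- The join `X ⊕ Y`: `X` on the even numbers, `Y` on the odd numbers. -/
def join (X Y : ℕ → ℕ) : ℕ → ℕ := fun m => if m % 2 = 0 then X (m / 2) else Y (m / 2)

/-- The finite join `X₀ ⊕ ⋯ ⊕ Xₙ₋₁`, with the value `Xᵢ(k)` at the number `⟨i, k⟩`
(and the value `0` when `i ≥ n`). -/
def tupleJoin {n : ℕ} (X : Fin n → ℕ → ℕ) : ℕ → ℕ := fun m =>
  if h : m.unpair.1 < n then X ⟨m.unpair.1, h⟩ m.unpair.2 else 0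

/-- The characteristic function of a set of natural numbers. -/
noncomputable def charFun (D : Set ℕ) : ℕ → ℕ := D.indicator 1

/-! ### Trees and paths -/

/-- The set `[T]` of infinite paths through `T ⊆ ω^{<ω}`. -/
def paths (T : Set (List ℕ)) : Set (ℕ → ℕ) := {X | ∀ n, (List.range n).map X ∈ T}

/-! ### Gödel numbers, in a countable functional signature with equality -/

/-- A numbering of the function symbols (constants have arity `0`). It is only used for a finite
signature, where each such numbering is computable. -/
class SymbolCoding (L : FirstOrder.Language.{0, 0}) where
  code : ∀ {n : ℕ}, L.Functions n → ℕ
  code_injective : ∀ n : ℕ, Function.Injective (code : L.Functions n → ℕ)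

section Goedel

variable {L : FirstOrder.Language.{0, 0}} [SymbolCoding L]

/-- The Gödel number of a term, given numbers for its variables. -/
def termCode {α : Type} (v : α → ℕ) : L.Term α → ℕ
  | .var a => Nat.pair 0 (v a)
  | .func (l := l) f ts =>
      Nat.pair 1 (Nat.pair l (Nat.pair (SymbolCoding.code f)
        (Encodable.encode (List.ofFn fun i => termCode v (ts i)))))

/-- The free variable `xᵢ` has the number `2i`, the `j`-th bound variable the number `2j+1`. -/
def varCode {n k : ℕ} : Fin n ⊕ Fin k → ℕ
  | .inl i => 2 * i.val
  | .inr j => 2 * j.val + 1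

/-- The Gödel number of a formula with free variables among `x₀, …, xₙ₋₁`. -/
def formulaCode [L.IsAlgebraic] {n : ℕ} : {k : ℕ} → L.BoundedFormula (Fin n) k → ℕ
  | _, .falsum => Nat.pair 0 0
  | _, .equal t₁ t₂ => Nat.pair 1 (Nat.pair (termCode varCode t₁) (termCode varCode t₂))
  | _, .rel R _ => isEmptyElim R
  | _, .imp φ ψ => Nat.pair 2 (Nat.pair (formulaCode φ) (formulaCode ψ))
  | _, .all φ => Nat.pair 3 (formulaCode φ)

end Goedel

/-! ### Computable tree presentations and tree-decidability -/

section Presentation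

variable (L : FirstOrder.Language.{0, 0}) [SymbolCoding L]

/-- The structure on `[T]` is a computable tree presentation: `T` is a computable subtree of
`ω^{<ω}` all of whose nodes are extendible, and the function symbols are interpreted by
Turing functionals, uniformly in the symbol. -/
structure IsComputableTreePresentation (T : Set (List ℕ)) [L.Structure (paths T)] : Prop where
  root_mem : [] ∈ T
  prefix_closed : ∀ σ τ : List ℕ, σ <+: τ → τ ∈ T → σ ∈ T
  computable : ComputablePred fun σ : List ℕ => σ ∈ T
  extendible : ∀ σ ∈ T, ∃ X ∈ paths T, (List.range σ.length).map X = σ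
  functional : ∃ Φ : OracleCode, ∀ (n : ℕ) (f : L.Functions n) (X : Fin n → paths T) (k : ℕ),
    Φ.eval (tupleJoin fun i => (X i : ℕ → ℕ)) (Nat.pair (Nat.pair n (SymbolCoding.code f)) k) =
      Part.some ((FirstOrder.Language.Structure.funMap f X : paths T).val k)

/-- `B` is an enumeration of `A`: viewed as a set of pairs, it projects onto `A`. -/
def IsEnumeration (B A : Set ℕ) : Prop := A = {x | ∃ y, Nat.pair x y ∈ B}

/-- The positive atomic diagram of the tuple `X`: the Gödel numbers of the atomic formulas true
of `X`, where the variable `xᵢ` plays the part of the new constant that names `Xᵢ`. -/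
def positiveAtomicDiagram [L.IsAlgebraic] {T : Set (List ℕ)} [L.Structure (paths T)] {n : ℕ}
    (X : Fin n → paths T) : Set ℕ :=
  {m | ∃ α : L.Formula (Fin n),
    FirstOrder.Language.BoundedFormula.IsAtomic α ∧ α.Realize X ∧ formulaCode α = m}

/-- One Turing functional `Φ` decides every formula `α` of every tuple `X` of paths, from the
oracle `X₀ ⊕ ⋯ ⊕ Xₙ₋₁ ⊕ D`, for each enumeration `D` of the positive atomic diagram of `X`. -/
def IsTreeDecidable [L.IsAlgebraic] (T : Set (List ℕ)) [L.Structure (paths T)] : Prop :=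
  ∃ Φ : OracleCode, ∀ (n : ℕ) (α : L.Formula (Fin n)) (X : Fin n → paths T) (D : Set ℕ),
    IsEnumeration D (positiveAtomicDiagram L X) →
      (α.Realize X →
        Φ.eval (join (tupleJoin fun i => (X i : ℕ → ℕ)) (charFun D)) (formulaCode α) =
          Part.some 1) ∧
      (¬ α.Realize X →
        Φ.eval (join (tupleJoin fun i => (X i : ℕ → ℕ)) (charFun D)) (formulaCode α) =
          Part.some 0)

end Presentation

/-! ### The signature of additive groups -/

/-- The function symbols `0`, `-`, `+`. -/
inductive AddGroupFunc : ℕ → Type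
  | zero : AddGroupFunc 0
  | neg : AddGroupFunc 1
  | add : AddGroupFunc 2

/-- The signature of additive groups, with equality as its only relation. -/
def addGroupLang : FirstOrder.Language.{0, 0} := ⟨AddGroupFunc, fun _ => Empty⟩

instance : addGroupLang.IsAlgebraic := fun _ => inferInstanceAs (IsEmpty Empty)

/-- The number of a symbol of the signature of additive groups. -/
def addGroupSymbolCode : {n : ℕ} → AddGroupFunc n → ℕ
  | _, .zero => 0
  | _, .neg => 1
  | _, .add => 2

instance : SymbolCoding addGroupLang where
  code := addGroupSymbolCode
  code_injective := by
    intro n f g _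
    cases f <;> cases g <;> rfl

/-- The interpretation of the symbols `0`, `-`, `+` by the operations of `A`. -/
instance addGroupStructure (A : Type) [Zero A] [Neg A] [Add A] : addGroupLang.Structure A where
  funMap := fun {n} (f : AddGroupFunc n) =>
    match n, f with
    | _, .zero => fun _ => 0
    | _, .neg => fun x => -x 0
    | _, .add => fun x => x 0 + x 1
  RelMap := fun {_} (r : Empty) => r.elim

/-! ### The tree `T_p^+` -/

/-- The finite sequences `(k₁, …, kₙ)` with `0 ≤ kᵢ < pⁱ` and `kᵢ₊₁ ≡ kᵢ mod pⁱ`;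
the entry `kᵢ` is `σ[i - 1]`. -/
def ZpTree (p : ℕ) : Set (List ℕ) :=
  {σ | (∀ (i : ℕ) (h : i < σ.length), σ[i] < p ^ (i + 1)) ∧
    ∀ (i : ℕ) (h : i + 1 < σ.length), σ[i + 1] ≡ σ[i] [MOD p ^ (i + 1)]}

theorem mem_paths_ZpTree {p : ℕ} {X : ℕ → ℕ} :
    X ∈ paths (ZpTree p) ↔
      (∀ i, X i < p ^ (i + 1)) ∧ ∀ i, X (i + 1) ≡ X i [MOD p ^ (i + 1)] := by
  constructor
  · intro h
    refine ⟨fun i => ?_, fun i => ?_⟩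
    · simpa using (h (i + 1)).1 i (by simp)
    · simpa using (h (i + 2)).2 i (by simp)
  · intro h n
    refine ⟨fun i hi => ?_, fun i hi => ?_⟩
    · simpa using h.1 i
    · simpa using h.2 i

/-- The elements of `ℤ_p⁺` as presented by the tree `T_p^+`. -/
abbrev ZpPaths (p : ℕ) : Type := ↥(paths (ZpTree p))

section Operations

variable {p : ℕ} [hp : Fact p.Prime]

theorem mod_mem_paths {F : ℕ → ℕ} (hF : ∀ i, F (i + 1) ≡ F i [MOD p ^ (i + 1)]) :
    (fun i => F i % p ^ (i + 1)) ∈ paths (ZpTree p) := by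
  refine mem_paths_ZpTree.2 ⟨fun i => Nat.mod_lt _ (pow_pos hp.out.pos _), fun i => ?_⟩
  have h1 : F (i + 1) % p ^ (i + 1 + 1) ≡ F (i + 1) [MOD p ^ (i + 1)] :=
    (Nat.mod_modEq (F (i + 1)) (p ^ (i + 1 + 1))).of_dvd (pow_dvd_pow p (Nat.le_succ _))
  exact (h1.trans (hF i)).trans (Nat.mod_modEq _ _).symm

/-- The identity element is the constant path `0`. -/
instance : Zero (ZpPaths p) :=
  ⟨⟨fun _ => 0, mem_paths_ZpTree.2 ⟨fun _ => pow_pos hp.out.pos _, fun _ => rfl⟩⟩⟩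

/-- Coordinatewise addition, modulo `pⁱ` in the `i`-th coordinate. -/
instance : Add (ZpPaths p) :=
  ⟨fun X Y => ⟨fun i => (X.1 i + Y.1 i) % p ^ (i + 1), mod_mem_paths fun i =>
    ((mem_paths_ZpTree.1 X.2).2 i).add ((mem_paths_ZpTree.1 Y.2).2 i)⟩⟩

/-- Coordinatewise negation, modulo `pⁱ` in the `i`-th coordinate. -/
instance : Neg (ZpPaths p) :=
  ⟨fun X => ⟨fun i => (p ^ (i + 1) - X.1 i) % p ^ (i + 1), mod_mem_paths fun i => by
    have h1 := (mem_paths_ZpTree.1 X.2).1 i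
    have h2 := (mem_paths_ZpTree.1 X.2).1 (i + 1)
    have h3 := (mem_paths_ZpTree.1 X.2).2 i
    refine Nat.ModEq.add_right_cancel h3 ?_
    rw [Nat.sub_add_cancel h2.le, Nat.sub_add_cancel h1.le]
    exact ((Nat.modEq_zero_iff_dvd.2 (pow_dvd_pow p (Nat.le_succ _))).trans
      (Nat.modEq_zero_iff_dvd.2 dvd_rfl).symm)⟩⟩

end Operations

end TreePres

namespace TreePres

open Nat.Partrec (Code)
open Encodable (encode)

/-! ### Recursion on codes -/

/-! Part (a) is direct: a path lists the residues of a unique `p`-adic integer, and coordinate `k`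
of a sum or negative depends only on coordinate `k` of the arguments.

Part (b) rests on a bounded back-and-forth. Two tuples of `p`-adic integers are similar at level `b`
(`Sim`) if they satisfy the same linear relations with coefficients of size at most `b` and agree
modulo `p ^ b` up to one common unit. Units must be allowed because multiplication by a unit is an
automorphism of the group. Similarity at level `2 * b ^ 2` extends to similarity at level `b` after
any element is added on one side (`Sim.exists_extend`). If the new element satisfies a small
relation, that relation determines its partner, and cross-multiplication eliminates the new variable
from all other relations. If not, the partner is taken in the right residue class outside a finite
exceptional set.

If the second tuple is integral, the partner can be an integer of computable size, after the old
tuple is multiplied by an integer that is a `p`-adic unit (`Sim.exists_extend_int`). So the truth of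
a formula at a tuple of `p`-adic integers is computed from a similar integral tuple, with every
quantifier running over a finite set of integers (`exists_partrec_realize`).

It remains to find such an integral tuple from the oracle. Congruences are read off the paths. That
a linear relation fails is seen at some finite level of the paths, and that it holds is eventually
confirmed by the enumeration of the positive atomic diagram. Only finitely many relations matter, so
a search recognises a suitable tuple (`sim_of_fits`), and one exists (`exists_eventually_fits`). -/

/-- Kleene's recursion theorem. It allows recursion on subterms and subformulas while other
parameters change, with no course-of-values encoding. -/
theorem exists_code_fixed_point {A : Type} [Primcodable A] {f : Code → A → Part ℕ}
    (hf : Partrec₂ (fun c a => f c a : Code → A →. ℕ)) :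
    ∃ c : Code, ∀ a : A, c.eval (encode a) = f c a := by
  have h : Partrec₂ fun (c : Code) (n : ℕ) =>
      ((Encodable.decode n : Option A) : Part A).bind (f c) :=
    Partrec.bind (Computable.ofOption (Computable.decode.comp Computable.snd))
      (hf.comp (Computable.fst.comp Computable.fst) Computable.snd)
  obtain ⟨c, hc⟩ := Nat.Partrec.Code.fixed_point₂ h
  refine ⟨c, fun a => (congrFun hc _).trans ?_⟩
  rw [Encodable.encodek]
  exact Part.bind_some a (f c)

theorem partrec_eval_encode {A B : Type} [Primcodable A] [Primcodable B] {c : B → Code}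
    {g : B → A} (hc : Computable c) (hg : Computable g) :
    Partrec fun b => (c b).eval (encode (g b)) :=
  Nat.Partrec.Code.eval_part.comp hc (Computable.encode.comp hg)

/-! ### Closure properties of primitive recursive functions and predicates -/

section PrimrecLemmas

variable {A B : Type} [Primcodable A] [Primcodable B]

theorem primrec_fst {f : A → ℕ} (hf : Primrec f) : Primrec fun a => (f a).unpair.1 :=
  Primrec.fst.comp (Primrec.unpair.comp hf)

theorem primrec_snd {f : A → ℕ} (hf : Primrec f) : Primrec fun a => (f a).unpair.2 :=
  Primrec.snd.comp (Primrec.unpair.comp hf)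

theorem primrec_pow {f g : A → ℕ} (hf : Primrec f) (hg : Primrec g) :
    Primrec fun a => f a ^ g a := by
  have h : Primrec fun a => Nat.rec (motive := fun _ => ℕ) 1 (fun _ x => x * f a) (g a) :=
    Primrec.nat_rec' hg (Primrec.const 1)
      (Primrec.nat_mul.comp (Primrec.snd.comp Primrec.snd) (hf.comp Primrec.fst)).to₂
  refine h.of_eq fun a => ?_
  induction g a with
  | zero => rfl
  | succ n ih => simp only [ih, pow_succ]

theorem primrec_sum_range {f : A → ℕ} {g : A → ℕ → ℕ} (hf : Primrec f) (hg : Primrec₂ g) :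
    Primrec fun a => ∑ i ∈ Finset.range (f a), g a i := by
  have h : Primrec fun a => Nat.rec (motive := fun _ => ℕ) 0 (fun i x => x + g a i) (f a) :=
    Primrec.nat_rec' hf (Primrec.const 0)
      (Primrec.nat_add.comp (Primrec.snd.comp Primrec.snd)
        (hg.comp Primrec.fst (Primrec.fst.comp Primrec.snd))).to₂
  refine h.of_eq fun a => ?_
  induction f a with
  | zero => rfl
  | succ n ih => simp only [ih, Finset.sum_range_succ]

theorem primrec_prod_range {f : A → ℕ} {g : A → ℕ → ℕ} (hf : Primrec f) (hg : Primrec₂ g) :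
    Primrec fun a => ∏ i ∈ Finset.range (f a), g a i := by
  have h : Primrec fun a => Nat.rec (motive := fun _ => ℕ) 1 (fun i x => x * g a i) (f a) :=
    Primrec.nat_rec' hf (Primrec.const 1)
      (Primrec.nat_mul.comp (Primrec.snd.comp Primrec.snd)
        (hg.comp Primrec.fst (Primrec.fst.comp Primrec.snd))).to₂
  refine h.of_eq fun a => ?_
  induction f a with
  | zero => rfl
  | succ n ih => simp only [ih, Finset.prod_range_succ]

theorem primrecPred_forall_lt {f : A → ℕ} {R : A → ℕ → Prop} (hf : Primrec f)
    (hR : PrimrecPred fun q : A × ℕ => R q.1 q.2) : PrimrecPred fun a => ∀ i < f a, R a i := by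
  have h : PrimrecRel fun (i : ℕ) (a : A) => R a i :=
    (PrimrecPred.comp hR (Primrec.snd.pair Primrec.fst)).primrecRel
  exact PrimrecPred.of_eq (h.forall_mem_list.comp (Primrec.list_range.comp hf)
    (g := fun a => a) Primrec.id) fun a => by simp

theorem primrecPred_exists_lt {f : A → ℕ} {R : A → ℕ → Prop} (hf : Primrec f)
    (hR : PrimrecPred fun q : A × ℕ => R q.1 q.2) : PrimrecPred fun a => ∃ i < f a, R a i := by
  have h : PrimrecRel fun (i : ℕ) (a : A) => R a i :=
    (PrimrecPred.comp hR (Primrec.snd.pair Primrec.fst)).primrecRel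
  exact PrimrecPred.of_eq (h.exists_mem_list.comp (Primrec.list_range.comp hf)
    (g := fun a => a) Primrec.id) fun a => by simp

theorem primrecPred_eq {f g : A → B} (hf : Primrec f) (hg : Primrec g) :
    PrimrecPred fun a => f a = g a :=
  Primrec.eq.comp hf hg

theorem primrecPred_lt {f g : A → ℕ} (hf : Primrec f) (hg : Primrec g) :
    PrimrecPred fun a => f a < g a :=
  Primrec.nat_lt.comp hf hg

theorem primrecPred_modEq {f g h : A → ℕ} (hf : Primrec f) (hg : Primrec g) (hh : Primrec h) :
    PrimrecPred fun a => f a ≡ g a [MOD h a] :=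
  primrecPred_eq (Primrec.nat_mod.comp hf hh) (Primrec.nat_mod.comp hg hh)

end PrimrecLemmas

/-! ### Arithmetic of Gödel numbers, and recursion along them -/

/-- The first entry of a list, from the number of the list. -/
def headCode (m : ℕ) : ℕ := (m - 1).unpair.1

/-- The second entry of a list, from the number of the list. -/
def secondCode (m : ℕ) : ℕ := headCode (m - 1).unpair.2

theorem headCode_encode (a : ℕ) (l : List ℕ) : headCode (encode (a :: l)) = a := by
  simp [headCode, Encodable.encode_list_cons]

theorem secondCode_encode (a b : ℕ) (l : List ℕ) : secondCode (encode (a :: b :: l)) = b := by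
  simp [secondCode, headCode, Encodable.encode_list_cons]

theorem primrec_headCode : Primrec headCode :=
  primrec_fst Primrec.pred

theorem primrec_secondCode : Primrec secondCode :=
  primrec_headCode.comp (primrec_snd Primrec.pred)

/-- The Gödel number of the term `0`. -/
def zeroCode : ℕ := Nat.pair 1 (Nat.pair 0 (Nat.pair 0 (encode ([] : List ℕ))))

/-- The Gödel number of the term `-t`, from that of `t`. -/
def negCode (a : ℕ) : ℕ := Nat.pair 1 (Nat.pair 1 (Nat.pair 1 (encode [a])))

/-- The Gödel number of the term `s + t`, from those of `s` and `t`. -/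
def addCode (a b : ℕ) : ℕ := Nat.pair 1 (Nat.pair 2 (Nat.pair 2 (encode [a, b])))

theorem primrec_addCode : Primrec₂ addCode := by
  refine Primrec₂.natPair.comp₂ (Primrec₂.const 1) (Primrec₂.natPair.comp₂ (Primrec₂.const 2)
    (Primrec₂.natPair.comp₂ (Primrec₂.const 2) (Primrec.encode.comp₂ ?_)))
  exact Primrec.list_cons.comp₂ Primrec₂.left
    (Primrec.list_cons.comp₂ Primrec₂.right (Primrec₂.const []))

/-- Recursion along the Gödel numbers of terms, with values in an algebra of natural numbers. -/
theorem exists_partrec_termRec {E : Type} [Primcodable E] {V : E → ℕ → ℕ} {Z : ℕ} {Ng : ℕ → ℕ}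
    {Ad : ℕ → ℕ → ℕ} (hV : Primrec₂ V) (hN : Primrec Ng) (hA : Primrec₂ Ad) :
    ∃ F : E → ℕ → Part ℕ, Partrec₂ (fun e n => F e n : E → ℕ →. ℕ) ∧
      (∀ e v, F e (Nat.pair 0 v) = Part.some (V e v)) ∧
      (∀ e, F e zeroCode = Part.some Z) ∧ (∀ e a, F e (negCode a) = (F e a).map Ng) ∧
      ∀ e a b, F e (addCode a b) = (F e a).bind fun x => (F e b).map (Ad x) := by
  let f : Code → E × ℕ → Part ℕ := fun c q =>
    bif decide (q.2.unpair.1 = 0) then Part.some (V q.1 q.2.unpair.2) else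
    -- The arity alone identifies the symbol in this signature, so the symbol number is never
    -- inspected.
    bif decide (q.2.unpair.2.unpair.1 = 0) then Part.some Z else
    bif decide (q.2.unpair.2.unpair.1 = 1) then
      (c.eval (encode (q.1, headCode q.2.unpair.2.unpair.2.unpair.2))).map Ng else
      (c.eval (encode (q.1, headCode q.2.unpair.2.unpair.2.unpair.2))).bind fun x =>
        (c.eval (encode (q.1, secondCode q.2.unpair.2.unpair.2.unpair.2))).map (Ad x)
  have hf : Partrec₂ (fun c q => f c q : Code → E × ℕ →. ℕ) := by
    have h2 : Primrec fun q : Code × (E × ℕ) => q.2.2 := Primrec.snd.comp Primrec.snd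
    have h1 : Primrec fun q : Code × (E × ℕ) => q.2.1 := Primrec.fst.comp Primrec.snd
    have hargs : Primrec fun q : Code × (E × ℕ) => q.2.2.unpair.2.unpair.2.unpair.2 :=
      primrec_snd (primrec_snd (primrec_snd h2))
    have e1 : Partrec fun q : Code × (E × ℕ) =>
        q.1.eval (encode (q.2.1, headCode q.2.2.unpair.2.unpair.2.unpair.2)) :=
      partrec_eval_encode Computable.fst (h1.pair (primrec_headCode.comp hargs)).to_comp
    have e2 : Partrec fun q : Code × (E × ℕ) =>
        q.1.eval (encode (q.2.1, secondCode q.2.2.unpair.2.unpair.2.unpair.2)) :=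
      partrec_eval_encode Computable.fst (h1.pair (primrec_secondCode.comp hargs)).to_comp
    refine Partrec.cond (primrecPred_eq (primrec_fst h2) (Primrec.const 0)).decide.to_comp
      (hV.comp h1 (primrec_snd h2)).to_comp.partrec ?_
    refine Partrec.cond
      (primrecPred_eq (primrec_fst (primrec_snd h2)) (Primrec.const 0)).decide.to_comp
      (Computable.const Z).partrec ?_
    refine Partrec.cond
      (primrecPred_eq (primrec_fst (primrec_snd h2)) (Primrec.const 1)).decide.to_comp
      (e1.map (hN.to_comp.comp Computable.snd).to₂) ?_
    exact e1.bind ((e2.comp Computable.fst).map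
      (hA.to_comp.comp (Computable.snd.comp Computable.fst) Computable.snd).to₂).to₂
  obtain ⟨c, hc⟩ := exists_code_fixed_point hf
  refine ⟨fun e t => c.eval (encode (e, t)), partrec_eval_encode (Computable.const c)
    (Computable.fst.pair Computable.snd), fun e v => ?_, fun e => ?_, fun e a => ?_,
    fun e a b => ?_⟩
  · refine (hc _).trans ?_; simp [f]
  · refine (hc _).trans ?_; simp [f, zeroCode]
  · refine (hc _).trans ?_; simp [f, negCode, headCode_encode,
      -Encodable.encode_list_cons, -Encodable.encode_prod_val]
  · refine (hc _).trans ?_; simp [f, addCode, headCode_encode, -Encodable.encode_list_cons,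
      secondCode_encode, -Encodable.encode_prod_val]

/-- Recursion along the Gödel numbers of formulas, with parameters that change at a quantifier,
where the values at finitely many parameters are combined. -/
theorem exists_partrec_formulaRec {E : Type} [Primcodable E] {fal ini : ℕ} {EQ : E → ℕ → ℕ → Part ℕ}
    {IMP STEP : ℕ → ℕ → ℕ} {H : E → ℕ → ℕ} {EXT : E × ℕ × ℕ → E}
    (hEQ : Partrec fun q : E × ℕ × ℕ => EQ q.1 q.2.1 q.2.2) (hI : Primrec₂ IMP)
    (hS : Primrec₂ STEP) (hH : Primrec₂ H) (hX : Primrec EXT) :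
    ∃ F : E → ℕ → Part ℕ, Partrec₂ (fun e n => F e n : E → ℕ →. ℕ) ∧
      (∀ e, F e (Nat.pair 0 0) = Part.some fal) ∧
      (∀ e a b, F e (Nat.pair 1 (Nat.pair a b)) = EQ e a b) ∧
      (∀ e a b, F e (Nat.pair 2 (Nat.pair a b)) =
        (F e a).bind fun x => (F e b).map (IMP x)) ∧
      ∀ e a, F e (Nat.pair 3 a) = Nat.rec (motive := fun _ => Part ℕ) (Part.some ini)
        (fun i IH => IH.bind fun acc => (F (EXT (e, a, i)) a).map (STEP acc)) (H e a) := by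
  let f : Code → E × ℕ → Part ℕ := fun c q =>
    bif decide (q.2.unpair.1 = 0) then Part.some fal else
    bif decide (q.2.unpair.1 = 1) then EQ q.1 q.2.unpair.2.unpair.1 q.2.unpair.2.unpair.2 else
    bif decide (q.2.unpair.1 = 2) then
      (c.eval (encode (q.1, q.2.unpair.2.unpair.1))).bind fun x =>
        (c.eval (encode (q.1, q.2.unpair.2.unpair.2))).map (IMP x) else
      Nat.rec (motive := fun _ => Part ℕ) (Part.some ini)
        (fun i IH => IH.bind fun acc =>
          (c.eval (encode (EXT (q.1, q.2.unpair.2, i), q.2.unpair.2))).map (STEP acc))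
        (H q.1 q.2.unpair.2)
  have hf : Partrec₂ (fun c q => f c q : Code → E × ℕ →. ℕ) := by
    have h2 : Primrec fun q : Code × (E × ℕ) => q.2.2 := Primrec.snd.comp Primrec.snd
    have h1 : Primrec fun q : Code × (E × ℕ) => q.2.1 := Primrec.fst.comp Primrec.snd
    have e1 : Partrec fun q : Code × (E × ℕ) =>
        q.1.eval (encode (q.2.1, q.2.2.unpair.2.unpair.1)) :=
      partrec_eval_encode Computable.fst (h1.pair (primrec_fst (primrec_snd h2))).to_comp
    have e2 : Partrec fun q : Code × (E × ℕ) =>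
        q.1.eval (encode (q.2.1, q.2.2.unpair.2.unpair.2)) :=
      partrec_eval_encode Computable.fst (h1.pair (primrec_snd (primrec_snd h2))).to_comp
    refine Partrec.cond (primrecPred_eq (primrec_fst h2) (Primrec.const 0)).decide.to_comp
      (Computable.const fal).partrec ?_
    refine Partrec.cond (primrecPred_eq (primrec_fst h2) (Primrec.const 1)).decide.to_comp
      (hEQ.comp (h1.pair ((primrec_fst (primrec_snd h2)).pair
        (primrec_snd (primrec_snd h2)))).to_comp) ?_
    refine Partrec.cond (primrecPred_eq (primrec_fst h2) (Primrec.const 2)).decide.to_comp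
      (e1.bind ((e2.comp Computable.fst).map
        (hI.to_comp.comp (Computable.snd.comp Computable.fst) Computable.snd).to₂).to₂) ?_
    refine Partrec.nat_rec (h := fun (q : Code × (E × ℕ)) (x : ℕ × ℕ) =>
      (q.1.eval (encode (EXT (q.2.1, q.2.2.unpair.2, x.1), q.2.2.unpair.2))).map (STEP x.2))
      (hH.comp h1 (primrec_snd h2)).to_comp (Computable.const ini).partrec ?_
    refine Partrec.map (partrec_eval_encode (Computable.fst.comp Computable.fst) ?_)
      (hS.to_comp.comp ((Computable.snd.comp Computable.snd).comp Computable.fst)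
        Computable.snd).to₂
    have h2' := (primrec_snd h2).comp (Primrec.fst (α := Code × (E × ℕ)) (β := ℕ × ℕ))
    exact ((hX.comp ((h1.comp Primrec.fst).pair (h2'.pair
      (Primrec.fst.comp Primrec.snd)))).pair h2').to_comp
  obtain ⟨c, hc⟩ := exists_code_fixed_point hf
  refine ⟨fun e t => c.eval (encode (e, t)), partrec_eval_encode (Computable.const c)
    (Computable.fst.pair Computable.snd), fun e => ?_, fun e a b => ?_, fun e a b => ?_,
    fun e a => ?_⟩
  · refine (hc _).trans ?_; simp [f]
  · refine (hc _).trans ?_; simp [f]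
  · refine (hc _).trans ?_; simp [f, -Encodable.encode_prod_val]
  · refine (hc _).trans ?_; simp [f, -Encodable.encode_prod_val]

/-! ### Programs with an oracle -/

theorem OracleCode.exists_eval_eq {f : ℕ →. ℕ} (hf : Nat.Partrec f) :
    ∃ Φ : OracleCode, ∀ g, Φ.eval g = f := by
  induction hf with
  | zero => exact ⟨.zero, fun g => rfl⟩
  | succ => exact ⟨.succ, fun g => rfl⟩
  | left => exact ⟨.left, fun g => rfl⟩
  | right => exact ⟨.right, fun g => rfl⟩
  | pair _ _ h1 h2 =>
    obtain ⟨a, ha⟩ := h1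
    obtain ⟨b, hb⟩ := h2
    exact ⟨.pair a b, fun g => by simp only [eval, ha, hb]; rfl⟩
  | comp _ _ h1 h2 =>
    obtain ⟨a, ha⟩ := h1
    obtain ⟨b, hb⟩ := h2
    exact ⟨.comp a b, fun g => by simp only [eval, ha, hb]; rfl⟩
  | prec _ _ h1 h2 =>
    obtain ⟨a, ha⟩ := h1
    obtain ⟨b, hb⟩ := h2
    exact ⟨.prec a b, fun g => by simp only [eval, ha, hb]; rfl⟩
  | rfind _ h1 =>
    obtain ⟨a, ha⟩ := h1
    exact ⟨.rfind a, fun g => by simp only [eval, ha]; rfl⟩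

theorem OracleCode.exists_eval_encode {A : Type} [Primcodable A] {f : A →. ℕ} (hf : Partrec f) :
    ∃ Φ : OracleCode, ∀ g a, Φ.eval g (encode a) = f a := by
  have h : Partrec fun n : ℕ => ((Encodable.decode n : Option A) : Part A).bind f :=
    Partrec.bind (Computable.ofOption Computable.decode) (hf.comp Computable.snd).to₂
  obtain ⟨Φ, hΦ⟩ := OracleCode.exists_eval_eq (Partrec.nat_iff.1 h)
  refine ⟨Φ, fun g a => (congrFun (hΦ g) _).trans ?_⟩
  rw [Encodable.encodek]
  exact Part.bind_some a f

theorem OracleCode.eval_pair_eq {a b : OracleCode} {g : ℕ → ℕ} {n x y : ℕ}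
    (ha : a.eval g n = Part.some x) (hb : b.eval g n = Part.some y) :
    (OracleCode.pair a b).eval g n = Part.some (Nat.pair x y) := by
  simp [eval, ha, hb, Seq.seq]

theorem OracleCode.eval_comp_eq {a b : OracleCode} {g : ℕ → ℕ} {n x : ℕ}
    (hb : b.eval g n = Part.some x) : (OracleCode.comp a b).eval g n = a.eval g x := by
  exact (congrArg (fun y => y >>= a.eval g) hb).trans (Part.bind_some x (a.eval g))

theorem OracleCode.exists_eval_primrec {f : ℕ → ℕ} (hf : Primrec f) :
    ∃ Φ : OracleCode, ∀ g n, Φ.eval g n = Part.some (f n) := by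
  obtain ⟨Φ, hΦ⟩ := OracleCode.exists_eval_eq (Partrec.nat_iff.1 hf.to_comp.partrec)
  exact ⟨Φ, fun g n => by rw [hΦ]; rfl⟩

/-- The first `n` values of the oracle. -/
def segment (g : ℕ → ℕ) (n : ℕ) : List ℕ := (List.range n).map g

/-- Computing an initial segment is the only use of the oracle in the search; the test applied to it
can then be an ordinary partial recursive function. -/
theorem OracleCode.exists_eval_segment :
    ∃ Φ : OracleCode, ∀ g n, Φ.eval g n = Part.some (encode (segment g n)) := by
  have hap : Partrec fun q : List ℕ × ℕ => (Part.some (encode (q.1 ++ [q.2])) : Part ℕ) :=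
    (Computable.encode.comp (Computable.list_concat.comp Computable.fst Computable.snd)).partrec
  obtain ⟨Ap, hAp⟩ := OracleCode.exists_eval_encode hap
  obtain ⟨P, hP⟩ := OracleCode.exists_eval_primrec
    (f := fun n => Nat.pair 0 n) (Primrec₂.natPair.comp (Primrec.const 0) Primrec.id)
  let b : OracleCode := .comp Ap (.pair (.comp .right .right) (.comp .oracle (.comp .left .right)))
  have hb : ∀ g n (l : List ℕ), b.eval g (Nat.pair 0 (Nat.pair n (encode l))) =
      Part.some (encode (l ++ [g n])) := by
    intro g n l
    have h := eval_pair_eq (a := .comp .right .right) (b := .comp .oracle (.comp .left .right))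
      (g := g) (n := Nat.pair 0 (Nat.pair n (encode l))) (x := encode l) (y := g n)
      (by simp [eval]) (by simp [eval])
    exact (eval_comp_eq h).trans (hAp g (l, g n))
  -- The base program `.zero` is correct because the empty list has the code `0`.
  refine ⟨.comp (.prec .zero b) P, fun g n => ?_⟩
  rw [eval_comp_eq (hP g n)]
  simp only [eval, Nat.unpair_pair]
  induction n with
  | zero => rfl
  | succ k ih =>
    refine (congrArg (fun x => x >>= fun i => b.eval g (Nat.pair 0 (Nat.pair k i))) ih).trans ?_
    refine (Part.bind_some _ (fun i => b.eval g (Nat.pair 0 (Nat.pair k i)))).trans ?_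
    simp only [hb, segment, List.range_succ, List.map_append, List.map_cons, List.map_nil]

/-- Unbounded search with a test that inspects a finite part of the oracle. -/
theorem OracleCode.exists_search {P : ℕ → ℕ → List ℕ → Part ℕ} {Q : ℕ → ℕ → Part ℕ}
    (hP : Partrec fun a : ℕ × ℕ × List ℕ => P a.1 a.2.1 a.2.2) (hQ : Partrec₂ (fun c w => Q c w : ℕ → ℕ →. ℕ)) :
    ∃ Φ : OracleCode, ∀ g c v, (∀ w, (P c w (segment g w)).Dom) →
      (∃ w, 0 ∈ P c w (segment g w)) → (∀ w, 0 ∈ P c w (segment g w) → Q c w = Part.some v) →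
      Φ.eval g c = Part.some v := by
  obtain ⟨p, hp⟩ := OracleCode.exists_eval_encode hP
  obtain ⟨q, hq⟩ := OracleCode.exists_eval_encode (A := ℕ × ℕ) hQ
  obtain ⟨s, hs⟩ := OracleCode.exists_eval_segment
  obtain ⟨i, hi⟩ := OracleCode.exists_eval_primrec (f := fun n => n) Primrec.id
  -- The number `w` is both the candidate and the length of the oracle segment that may be
  -- inspected.
  let t : OracleCode := .comp p (.pair .left (.pair .right (.comp s .right)))
  have ht : ∀ g c w, t.eval g (Nat.pair c w) = P c w (segment g w) := by
    intro g c w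
    have h1 := eval_comp_eq (a := s) (b := .right) (g := g) (n := Nat.pair c w) (x := w)
      (by simp [eval])
    rw [hs] at h1
    have h2 := eval_pair_eq (a := .left) (x := c) (by simp [eval])
      (eval_pair_eq (a := .right) (x := w) (by simp [eval]) h1)
    refine (eval_comp_eq h2).trans ?_
    simpa using hp g (c, w, segment g w)
  refine ⟨.comp q (.pair i (.rfind t)), fun g c v hd he hv => ?_⟩
  obtain ⟨w, hw⟩ : ∃ w, w ∈ (OracleCode.rfind t).eval g c := by
    rw [← Part.dom_iff_mem]
    obtain ⟨w, hw⟩ := he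
    refine Nat.rfind_dom'.2 ⟨w, ?_, fun _ => ?_⟩
    · rw [ht]
      simpa using hw
    · rw [ht]
      exact hd _
  have hw0 : 0 ∈ P c w (segment g w) := by
    have := Nat.rfind_spec hw
    rw [ht] at this
    simpa using this
  rw [eval_comp_eq (eval_pair_eq (hi g c) (Part.eq_some_iff.2 hw))]
  rw [← hv w hw0]
  simpa using hq g (c, w)

end TreePres

namespace TreePres

/-! ### An integer multiplier that is a `p`-adic unit -/

/-- A number prime to `p` that is divisible by all `c ≤ b` prime to `p`. -/
def unitProd (p b : ℕ) : ℕ := ∏ c ∈ Finset.range (b + 1), if c % p = 0 then 1 else c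

theorem dvd_unitProd {p b c : ℕ} (hc : c ≤ b) (h : ¬ p ∣ c) : c ∣ unitProd p b := by
  have := Finset.dvd_prod_of_mem (fun c => if c % p = 0 then 1 else c)
    (Finset.mem_range.2 (Nat.lt_succ_of_le hc))
  rwa [if_neg fun h' => h (Nat.dvd_of_mod_eq_zero h')] at this

theorem unitProd_pos (p b : ℕ) : 0 < unitProd p b :=
  Finset.prod_pos fun c _ => by
    split_ifs with h
    · exact one_pos
    · exact Nat.pos_of_ne_zero fun h' => h (by simp [h'])

/-! ### Back and forth between tuples of `p`-adic integers -/

section BackAndForth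

variable {p : ℕ} [hp : Fact p.Prime]

/-- Two tuples of length `m` satisfy the same integral linear relations with coefficients bounded
by `b`, and agree modulo `p ^ b` up to a unit. -/
def Sim (b m : ℕ) (x z : ℕ → ℤ_[p]) : Prop :=
  (∀ a : ℕ → ℤ, (∀ i, |a i| ≤ b) →
    (∑ i ∈ Finset.range m, (a i : ℤ_[p]) * x i = 0 ↔
      ∑ i ∈ Finset.range m, (a i : ℤ_[p]) * z i = 0)) ∧
  ∃ u : ℤ_[p]ˣ, ∀ i < m, (p : ℤ_[p]) ^ b ∣ z i - u * x i

theorem Sim.symm {b m : ℕ} {x z : ℕ → ℤ_[p]} (h : Sim b m x z) : Sim b m z x := by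
  obtain ⟨h1, u, hu⟩ := h
  refine ⟨fun a ha => (h1 a ha).symm, u⁻¹, fun i hi => ?_⟩
  have : x i - ↑u⁻¹ * z i = -(↑u⁻¹ : ℤ_[p]) * (z i - u * x i) := by
    have h : (↑u⁻¹ : ℤ_[p]) * u = 1 := u.inv_mul
    linear_combination (-x i) * h
  rw [this]
  exact (hu i hi).mul_left _

theorem Sim.congr {b m : ℕ} {x x' z z' : ℕ → ℤ_[p]} (h : Sim b m x z) (hx : ∀ i < m, x' i = x i)
    (hz : ∀ i < m, z' i = z i) : Sim b m x' z' := by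
  obtain ⟨h1, u, hu⟩ := h
  refine ⟨fun a ha => ?_, u, fun i hi => by rw [hx i hi, hz i hi]; exact hu i hi⟩
  have ex : ∑ i ∈ Finset.range m, (a i : ℤ_[p]) * x' i =
      ∑ i ∈ Finset.range m, (a i : ℤ_[p]) * x i :=
    Finset.sum_congr rfl fun i hi => by rw [hx i (Finset.mem_range.1 hi)]
  have ez : ∑ i ∈ Finset.range m, (a i : ℤ_[p]) * z' i =
      ∑ i ∈ Finset.range m, (a i : ℤ_[p]) * z i :=
    Finset.sum_congr rfl fun i hi => by rw [hz i (Finset.mem_range.1 hi)]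
  rw [ex, ez, h1 a ha]

theorem Sim.mono {b b' m : ℕ} {x z : ℕ → ℤ_[p]} (h : Sim b' m x z) (hb : b ≤ b') :
    Sim b m x z := by
  obtain ⟨h1, u, hu⟩ := h
  exact ⟨fun a ha => h1 a fun i => (ha i).trans (by exact_mod_cast hb), u,
    fun i hi => (pow_dvd_pow _ hb).trans (hu i hi)⟩

theorem Sim.unit_mul {b m : ℕ} {x z : ℕ → ℤ_[p]} (h : Sim b m x z) (w : ℤ_[p]ˣ) :
    Sim b m x fun i => w * z i := by
  obtain ⟨h1, u, hu⟩ := h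
  refine ⟨fun a ha => ?_, w * u, fun i hi => ?_⟩
  · rw [h1 a ha]
    have : ∑ i ∈ Finset.range m, (a i : ℤ_[p]) * (w * z i) =
        w * ∑ i ∈ Finset.range m, (a i : ℤ_[p]) * z i := by
      rw [Finset.mul_sum]
      exact Finset.sum_congr rfl fun i _ => by ring
    rw [this, Units.mul_right_eq_zero]
  · have : (w : ℤ_[p]) * z i - ↑(w * u) * x i = w * (z i - u * x i) := by
      push_cast; ring
    rw [this]
    exact (hu i hi).mul_left _

theorem sum_mul_update {R : Type} [CommRing R] (m : ℕ) (a x : ℕ → R) (y : R) :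
    ∑ i ∈ Finset.range (m + 1), a i * Function.update x m y i =
      ∑ i ∈ Finset.range m, a i * x i + a m * y := by
  rw [Finset.sum_range_succ, Function.update_self]
  congr 1
  refine Finset.sum_congr rfl fun i hi => ?_
  rw [Function.update_of_ne (Finset.mem_range.1 hi).ne]

/-- The valuation `j` of `c` satisfies `j < p ^ j ≤ |c| ≤ b`. Hence division by `c` costs at most
`b` digits of precision. -/
theorem exists_intCast_eq_pow_mul_unit {b : ℕ} {c : ℤ} (hc : c ≠ 0) (hcb : |c| ≤ b) :
    ∃ j ≤ b, ∃ u : ℤ_[p]ˣ, (c : ℤ_[p]) = (p : ℤ_[p]) ^ j * u := by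
  have hc' : (c : ℤ_[p]) ≠ 0 := by exact_mod_cast hc
  have h := PadicInt.unitCoeff_spec hc'
  refine ⟨(c : ℤ_[p]).valuation, ?_, PadicInt.unitCoeff hc', by rw [mul_comm]; exact h⟩
  have hd : (p : ℤ_[p]) ^ (c : ℤ_[p]).valuation ∣ c := ⟨_, by rw [mul_comm]; exact h⟩
  have hd' := (PadicInt.pow_p_dvd_int_iff _ _).1 hd
  have h1 : ((p ^ (c : ℤ_[p]).valuation : ℕ) : ℤ) ≤ b :=
    (Int.le_of_dvd (abs_pos.2 hc) ((dvd_abs _ _).2 (by exact_mod_cast hd'))).trans hcb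
  have h2 := Nat.lt_pow_self (n := (c : ℤ_[p]).valuation) hp.out.one_lt
  have h3 : p ^ (c : ℤ_[p]).valuation ≤ b := by exact_mod_cast h1
  omega

theorem dvd_sum_sub {b m : ℕ} {x z : ℕ → ℤ_[p]} {u : ℤ_[p]}
    (hu : ∀ i < m, (p : ℤ_[p]) ^ b ∣ z i - u * x i) (a : ℕ → ℤ) :
    (p : ℤ_[p]) ^ b ∣ ∑ i ∈ Finset.range m, (a i : ℤ_[p]) * z i -
      u * ∑ i ∈ Finset.range m, (a i : ℤ_[p]) * x i := by
  rw [Finset.mul_sum, ← Finset.sum_sub_distrib]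
  refine Finset.dvd_sum fun i hi => ?_
  have : (a i : ℤ_[p]) * z i - u * (a i * x i) = a i * (z i - u * x i) := by ring
  rw [this]
  exact (hu i (Finset.mem_range.1 hi)).mul_left _

/-- Solving a linear equation approximately transported by `u`: the quotient `-sz / c` exists and is
close to `u * y`, because `sz` is close to `u * sx` with enough spare digits for the division. -/
theorem exists_mul_eq_and_dvd_sub {b n : ℕ} {u : ℤ_[p]ˣ} {c : ℤ} {sx sz y : ℤ_[p]} (hc : c ≠ 0)
    (hcb : |c| ≤ b) (hn : b + b ≤ n) (hd : (p : ℤ_[p]) ^ n ∣ sz - u * sx)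
    (hy : sx + c * y = 0) : ∃ y', sz + c * y' = 0 ∧ (p : ℤ_[p]) ^ b ∣ y' - u * y := by
  obtain ⟨j, hj, v, hv⟩ := exists_intCast_eq_pow_mul_unit (p := p) hc hcb
  have hv1 : (↑v⁻¹ : ℤ_[p]) * v = 1 := v.inv_mul
  obtain ⟨k, hk⟩ := (pow_dvd_pow _ (show j + b ≤ n by omega)).trans hd
  rw [pow_add] at hk
  -- With `c = p ^ j * v`, the correction to `u * y` is `(sz - u * sx) / c`.
  refine ⟨u * y - ↑v⁻¹ * ((p : ℤ_[p]) ^ b * k), ?_, -(↑v⁻¹ * k), by ring⟩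
  rw [hv] at hy ⊢
  linear_combination hk + (u : ℤ_[p]) * hy - ((p : ℤ_[p]) ^ j * (p : ℤ_[p]) ^ b * k) * hv1

/-- Elimination of the new variable: `c` times the relation `d` minus `d m` times the relation `a`
involves old elements only, and multiplication by `c ≠ 0` loses nothing in a domain. -/
theorem sum_mul_eq_zero_iff_of_relation {R : Type} [CommRing R] [IsDomain R] {m : ℕ}
    {a d w : ℕ → ℤ} {x z : ℕ → R} {c : ℤ} {y y' : R} (hc : (c : R) ≠ 0)
    (hw : ∀ i, w i = c * d i - d m * a i)
    (h : ∑ i ∈ Finset.range m, (w i : R) * x i = 0 ↔ ∑ i ∈ Finset.range m, (w i : R) * z i = 0)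
    (hx : ∑ i ∈ Finset.range m, (a i : R) * x i + c * y = 0)
    (hz : ∑ i ∈ Finset.range m, (a i : R) * z i + c * y' = 0) :
    ∑ i ∈ Finset.range m, (d i : R) * x i + d m * y = 0 ↔
      ∑ i ∈ Finset.range m, (d i : R) * z i + d m * y' = 0 := by
  have expand : ∀ (t : ℕ → R) (s : R), ∑ i ∈ Finset.range m, (a i : R) * t i + c * s = 0 →
      ∑ i ∈ Finset.range m, (w i : R) * t i =
        c * (∑ i ∈ Finset.range m, (d i : R) * t i + d m * s) := by
    intro t s hs
    have : ∑ i ∈ Finset.range m, (w i : R) * t i = c * ∑ i ∈ Finset.range m, (d i : R) * t i -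
        d m * ∑ i ∈ Finset.range m, (a i : R) * t i := by
      rw [Finset.mul_sum, Finset.mul_sum, ← Finset.sum_sub_distrib]
      refine Finset.sum_congr rfl fun i _ => ?_
      rw [hw]
      push_cast
      ring
    rw [this]
    linear_combination (-(d m : R)) * hs
  rw [expand x y hx, expand z y' hz] at h
  simpa [hc] using h

/-- The new element is determined by the old ones. -/
theorem Sim.extend_of_relation {b m : ℕ} {x z : ℕ → ℤ_[p]} (h : Sim (2 * b ^ 2) m x z)
    {y : ℤ_[p]} {a : ℕ → ℤ} {c : ℤ} (ha : ∀ i, |a i| ≤ b) (hc : c ≠ 0) (hcb : |c| ≤ b)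
    (hy : ∑ i ∈ Finset.range m, (a i : ℤ_[p]) * x i + c * y = 0) :
    ∃ y', ∑ i ∈ Finset.range m, (a i : ℤ_[p]) * z i + c * y' = 0 ∧
      Sim b (m + 1) (Function.update x m y) (Function.update z m y') := by
  obtain ⟨h1, u, hu⟩ := h
  have hb : 1 ≤ b := by
    have := abs_pos.2 hc
    omega
  -- The level `2 * b ^ 2` serves twice: as a precision of at least `2 * b` digits, and as a bound
  -- for the cross-multiplied coefficients `c * d i - d m * a i`.
  have hbb : b + b ≤ 2 * b ^ 2 := by nlinarith
  obtain ⟨y', hrel, hdvd⟩ := exists_mul_eq_and_dvd_sub hc hcb hbb (dvd_sum_sub hu a) hy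
  refine ⟨y', hrel, fun d hdb => ?_, u, fun i hi => ?_⟩
  · rw [sum_mul_update m (fun i => (d i : ℤ_[p])), sum_mul_update m (fun i => (d i : ℤ_[p]))]
    refine sum_mul_eq_zero_iff_of_relation (by exact_mod_cast hc) (fun _ => rfl)
      (h1 (fun i => c * d i - d m * a i) fun i => ?_) hy hrel
    have e1 : |c * d i| ≤ b * b := by
      rw [abs_mul]; exact mul_le_mul hcb (hdb i) (abs_nonneg _) (by positivity)
    have e2 : |d m * a i| ≤ b * b := by
      rw [abs_mul]; exact mul_le_mul (hdb m) (ha i) (abs_nonneg _) (by positivity)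
    have e3 := abs_sub (c * d i) (d m * a i)
    push_cast
    linarith [sq (b : ℤ)]
  · rcases Nat.lt_succ_iff_lt_or_eq.1 hi with hi | rfl
    · rw [Function.update_of_ne hi.ne, Function.update_of_ne hi.ne]
      exact (pow_dvd_pow _ (by omega)).trans (hu i hi)
    · rwa [Function.update_self, Function.update_self]

/-- The new elements satisfy no relation with the old ones. -/
theorem Sim.extend_of_forall_ne {b m : ℕ} {x z : ℕ → ℤ_[p]} {u : ℤ_[p]ˣ}
    (h : ∀ a : ℕ → ℤ, (∀ i, |a i| ≤ b) →
      (∑ i ∈ Finset.range m, (a i : ℤ_[p]) * x i = 0 ↔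
        ∑ i ∈ Finset.range m, (a i : ℤ_[p]) * z i = 0))
    (hu : ∀ i < m, (p : ℤ_[p]) ^ b ∣ z i - u * x i) {y y' : ℤ_[p]}
    (hy : (p : ℤ_[p]) ^ b ∣ y' - u * y)
    (hx : ∀ (a : ℕ → ℤ) (c : ℤ), (∀ i, |a i| ≤ b) → c ≠ 0 → |c| ≤ b →
      ∑ i ∈ Finset.range m, (a i : ℤ_[p]) * x i + c * y ≠ 0)
    (hz : ∀ (a : ℕ → ℤ) (c : ℤ), (∀ i, |a i| ≤ b) → c ≠ 0 → |c| ≤ b →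
      ∑ i ∈ Finset.range m, (a i : ℤ_[p]) * z i + c * y' ≠ 0) :
    Sim b (m + 1) (Function.update x m y) (Function.update z m y') := by
  refine ⟨fun a ha => ?_, u, fun i hi => ?_⟩
  · rw [sum_mul_update m (fun i => (a i : ℤ_[p])), sum_mul_update m (fun i => (a i : ℤ_[p]))]
    -- A relation that involves the new element fails on both sides; any other one concerns the old
    -- tuples.
    by_cases hm : a m = 0
    · simpa [hm] using h a ha
    · exact iff_of_false (hx a (a m) ha hm (ha m)) (hz a (a m) ha hm (ha m))
  · rcases Nat.lt_succ_iff_lt_or_eq.1 hi with hi | rfl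
    · rw [Function.update_of_ne hi.ne, Function.update_of_ne hi.ne]
      exact hu i hi
    · rw [Function.update_self, Function.update_self]
      exact hy

/-- Each relation with `c ≠ 0` excludes at most one value, finitely many relations have bounded
coefficients, and a residue class is infinite. -/
theorem exists_congruent_of_forall_ne (b m : ℕ) (x : ℕ → ℤ_[p]) (t : ℤ_[p]) :
    ∃ y, (p : ℤ_[p]) ^ b ∣ y - t ∧ ∀ (a : ℕ → ℤ) (c : ℤ), (∀ i, |a i| ≤ b) → c ≠ 0 → |c| ≤ b →
      ∑ i ∈ Finset.range m, (a i : ℤ_[p]) * x i + c * y ≠ 0 := by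
  have hp0 : (p : ℤ_[p]) ≠ 0 := by exact_mod_cast hp.out.ne_zero
  -- Coefficients are cut down to `Fin m`: bounded functions on all of `ℕ` would not form a finite
  -- set.
  let bad : (Fin m → ℤ) × ℤ → Set ℤ_[p] := fun q =>
    {y | q.2 ≠ 0 ∧ ∑ i, (q.1 i : ℤ_[p]) * x i + q.2 * y = 0}
  let I : Set ((Fin m → ℤ) × ℤ) := (Set.pi Set.univ fun _ => Set.Icc (-b : ℤ) b) ×ˢ Set.Icc (-b : ℤ) b
  have hI : I.Finite := (Set.Finite.pi fun _ => Set.finite_Icc _ _).prod (Set.finite_Icc _ _)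
  have hbad : (⋃ q ∈ I, bad q).Finite := by
    refine hI.biUnion fun q _ => Set.Subsingleton.finite fun y hy y' hy' => ?_
    have hq : (q.2 : ℤ_[p]) ≠ 0 := by exact_mod_cast hy.1
    exact mul_left_cancel₀ hq (add_left_cancel (hy.2.trans hy'.2.symm))
  have hinf : (Set.range fun n : ℕ => t + (p : ℤ_[p]) ^ b * n).Infinite := by
    refine Set.infinite_range_of_injective fun n k hnk => ?_
    have := mul_left_cancel₀ (pow_ne_zero _ hp0) (add_left_cancel hnk)
    exact_mod_cast this
  obtain ⟨y, ⟨n, rfl⟩, hy⟩ := (hinf.sdiff hbad).nonempty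
  refine ⟨_, ⟨n, add_sub_cancel_left _ _⟩, fun a c ha hc hcb h0 => hy ?_⟩
  refine Set.mem_biUnion (x := (fun i : Fin m => a i, c))
    ⟨fun i _ => abs_le.1 (ha i), abs_le.1 hcb⟩ ⟨hc, ?_⟩
  rw [← h0, Finset.sum_range fun i => (a i : ℤ_[p]) * x i]

/-- The back-and-forth step: the cases are whether or not `y` satisfies a relation over `x` with
coefficients at most `b`. -/
theorem Sim.exists_extend {b m : ℕ} {x z : ℕ → ℤ_[p]} (h : Sim (2 * b ^ 2) m x z) (y : ℤ_[p]) :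
    ∃ y', Sim b (m + 1) (Function.update x m y) (Function.update z m y') := by
  by_cases hx : ∀ (a : ℕ → ℤ) (c : ℤ), (∀ i, |a i| ≤ b) → c ≠ 0 → |c| ≤ b →
      ∑ i ∈ Finset.range m, (a i : ℤ_[p]) * x i + c * y ≠ 0
  · obtain ⟨h1, u, hu⟩ := h.mono (show b ≤ 2 * b ^ 2 by nlinarith [Nat.le_self_pow two_ne_zero b])
    obtain ⟨y', hy', hz⟩ := exists_congruent_of_forall_ne b m z ((u : ℤ_[p]) * y)
    exact ⟨y', Sim.extend_of_forall_ne h1 hu hy' hx hz⟩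
  · push Not at hx
    obtain ⟨a, c, ha, hc, hcb, hy⟩ := hx
    obtain ⟨y', -, hy'⟩ := h.extend_of_relation ha hc hcb hy
    exact ⟨y', hy'⟩

/-! ### Integral tuples -/

theorem coprime_unitProd (b : ℕ) : Nat.Coprime p (unitProd p b) := by
  refine Nat.Coprime.prod_right fun c _ => ?_
  split_ifs with h
  · exact Nat.coprime_one_right p
  · exact (Nat.Prime.coprime_iff_not_dvd hp.out).2 fun h' => h (Nat.mod_eq_zero_of_dvd h')

theorem isUnit_natCast_of_coprime {n : ℕ} (h : Nat.Coprime p n) : IsUnit (n : ℤ_[p]) := by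
  rw [PadicInt.isUnit_iff]
  have h1 := PadicInt.norm_le_one (n : ℤ_[p])
  refine le_antisymm h1 (not_lt.1 fun hlt => ?_)
  have h2 : ‖((n : ℤ) : ℤ_[p])‖ < 1 := by exact_mod_cast hlt
  rw [PadicInt.norm_int_lt_one_iff_dvd] at h2
  exact (Nat.Prime.coprime_iff_not_dvd hp.out).1 h (by exact_mod_cast h2)

/-- Up to sign `c = p ^ j * c'` with `c'` prime to `p` and at most `b`. The `p`-adic hypothesis
gives `p ^ j ∣ s`, and `c'` divides the multiplier. Thus a division possible in `ℤ_[p]` becomes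
possible in `ℤ` after scaling. -/
theorem dvd_unitProd_mul_of_padic {b : ℕ} {c s : ℤ} (hc : c ≠ 0) (hcb : |c| ≤ b)
    (h : (c : ℤ_[p]) ∣ s) : c ∣ unitProd p b * s := by
  have hc0 : c.natAbs ≠ 0 := Int.natAbs_ne_zero.2 hc
  obtain ⟨j, c', hp', hcc⟩ := Nat.exists_eq_pow_mul_and_not_dvd hc0 p hp.out.ne_one
  have hcb' : c.natAbs ≤ b := by
    rw [Int.abs_eq_natAbs] at hcb
    exact_mod_cast hcb
  have hc'b : c' ≤ b := by
    refine le_trans ?_ hcb'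
    rw [hcc]
    exact Nat.le_mul_of_pos_left _ (pow_pos hp.out.pos _)
  have h1 : ((p ^ j : ℕ) : ℤ) ∣ c := Int.natCast_dvd.2 ⟨c', hcc⟩
  have h2 : (p : ℤ_[p]) ^ j ∣ (s : ℤ_[p]) := by
    refine Dvd.dvd.trans ?_ h
    obtain ⟨d, hd⟩ := h1
    exact ⟨d, by rw [hd]; push_cast; ring⟩
  have h3 := (PadicInt.pow_p_dvd_int_iff _ _).1 h2
  rw [← Int.natAbs_dvd, hcc, mul_comm (p ^ j) c']
  push_cast
  exact mul_dvd_mul (by exact_mod_cast dvd_unitProd hc'b hp') (by exact_mod_cast h3)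

theorem abs_sum_mul_le {b m : ℕ} {a z : ℕ → ℤ} {S : ℤ} (ha : ∀ i, |a i| ≤ b)
    (hS : ∑ i ∈ Finset.range m, |z i| ≤ S) : |∑ i ∈ Finset.range m, a i * z i| ≤ b * S := by
  refine (Finset.abs_sum_le_sum_abs _ _).trans ?_
  refine le_trans ?_ (mul_le_mul_of_nonneg_left hS (by positivity))
  rw [Finset.mul_sum]
  exact Finset.sum_le_sum fun i _ => by
    rw [abs_mul]; exact mul_le_mul_of_nonneg_right (ha i) (abs_nonneg _)

/-- After multiplication by a suitable unit, an integral tuple has integral extensions of bounded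
size for all purposes. -/
theorem Sim.exists_extend_int {b m S : ℕ} {x : ℕ → ℤ_[p]} {z : ℕ → ℤ}
    (h : Sim (2 * b ^ 2) m x fun i => (z i : ℤ_[p])) (hS : ∑ i ∈ Finset.range m, |z i| ≤ S)
    (y : ℤ_[p]) : ∃ y' : ℤ, |y'| ≤ (p ^ b * (b * unitProd p b * S + 2) : ℕ) ∧
      Sim b (m + 1) (Function.update x m y)
        fun i => (Function.update (fun i => unitProd p b * z i) m y' i : ℤ) := by
  set Q := unitProd p b with hQ
  have hQ0 : 0 < Q := unitProd_pos p b
  obtain ⟨w, hw⟩ := isUnit_natCast_of_coprime (coprime_unitProd (p := p) b)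
  rw [← hQ] at hw
  have hp1 : 1 ≤ p ^ b := Nat.one_le_pow _ _ hp.out.pos
  have hcast : ∀ y' : ℤ, (fun i => ((Function.update (fun i => Q * z i) m y' i : ℤ) : ℤ_[p])) =
      Function.update (fun i => w * (z i : ℤ_[p])) m y' := by
    intro y'
    funext i
    by_cases hi : i = m
    · subst hi; simp
    · simp [Function.update_of_ne hi, hw]
  have hsum : ∀ a : ℕ → ℤ, ∑ i ∈ Finset.range m, (a i : ℤ_[p]) * (w * (z i : ℤ_[p])) =
      ((Q * ∑ i ∈ Finset.range m, a i * z i : ℤ) : ℤ_[p]) := by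
    intro a
    push_cast
    rw [Finset.mul_sum]
    exact Finset.sum_congr rfl fun i _ => by rw [hw]; ring
  have hbound : ∀ a : ℕ → ℤ, (∀ i, |a i| ≤ b) →
      |(Q : ℤ) * ∑ i ∈ Finset.range m, a i * z i| ≤ b * Q * S := by
    intro a ha
    rw [abs_mul, Nat.abs_cast]
    calc (Q : ℤ) * |∑ i ∈ Finset.range m, a i * z i| ≤ Q * (b * S) :=
          mul_le_mul_of_nonneg_left (abs_sum_mul_le ha hS) (by positivity)
      _ = _ := by ring
  simp only [hcast]
  by_cases hx : ∀ (a : ℕ → ℤ) (c : ℤ), (∀ i, |a i| ≤ b) → c ≠ 0 → |c| ≤ b →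
      ∑ i ∈ Finset.range m, (a i : ℤ_[p]) * x i + c * y ≠ 0
  · obtain ⟨h1, u, hu⟩ := (h.mono
      (show b ≤ 2 * b ^ 2 by nlinarith [Nat.le_self_pow two_ne_zero b])).unit_mul w
    set r := PadicInt.appr ((u : ℤ_[p]) * y) b with hr
    have hrlt : r < p ^ b := PadicInt.appr_lt _ _
    -- The residue `r` gives the required congruence. The multiple of `p ^ b` makes the integer
    -- exceed every value `b * Q * S` of a bounded linear form at the scaled tuple, so no relation
    -- with nonzero last coefficient can hold.
    refine ⟨(r + p ^ b * (b * Q * S + 1) : ℕ), ?_, ?_⟩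
    · rw [Nat.abs_cast]
      have : r + p ^ b * (b * Q * S + 1) ≤ p ^ b * (b * Q * S + 2) := by nlinarith
      exact_mod_cast this
    · refine Sim.extend_of_forall_ne h1 hu ?_ hx ?_
      · have := Ideal.mem_span_singleton.1 (PadicInt.appr_spec b ((u : ℤ_[p]) * y))
        rw [← hr] at this
        obtain ⟨k, hk⟩ := this
        refine ⟨(b * Q * S + 1) - k, ?_⟩
        push_cast
        linear_combination -hk
      · intro a c ha hc hcb h0
        rw [hsum] at h0
        have h0' : (Q * ∑ i ∈ Finset.range m, a i * z i : ℤ) +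
            c * ((r + p ^ b * (b * Q * S + 1) : ℕ) : ℤ) = 0 := by
          exact_mod_cast h0
        have e1 := hbound a ha
        have e2 : |c * ((r + p ^ b * (b * Q * S + 1) : ℕ) : ℤ)| ≤ b * Q * S := by
          rw [← abs_neg]
          rwa [eq_neg_of_add_eq_zero_left h0'] at e1
        rw [abs_mul, Nat.abs_cast] at e2
        have e3 : 1 ≤ |c| := Int.one_le_abs hc
        have e4 : b * Q * S + 1 ≤ r + p ^ b * (b * Q * S + 1) :=
          (Nat.le_mul_of_pos_left _ hp1).trans (Nat.le_add_left _ _)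
        have e5 : ((b * Q * S + 1 : ℕ) : ℤ) ≤ (r + p ^ b * (b * Q * S + 1) : ℕ) := by
          exact_mod_cast e4
        have e6 := le_mul_of_one_le_left
          (Int.natCast_nonneg (r + p ^ b * (b * Q * S + 1))) e3
        push_cast at e2 e5 e6
        linarith
  · push Not at hx
    obtain ⟨a, c, ha, hc, hcb, hy⟩ := hx
    obtain ⟨y', hrel, hsim⟩ := (h.unit_mul w).extend_of_relation ha hc hcb hy
    -- The scaled form is divisible by `c` in `ℤ_[p]`, and the scaling factor is a unit there. Hence
    -- the partner `y'` found in `ℤ_[p]` turns out to be an integer.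
    have hsz : (c : ℤ_[p]) ∣ ((∑ i ∈ Finset.range m, a i * z i : ℤ) : ℤ_[p]) := by
      rw [hsum] at hrel
      push_cast at hrel ⊢
      refine ⟨-(↑w⁻¹ * y'), ?_⟩
      have hw1 : (↑w⁻¹ : ℤ_[p]) * w = 1 := w.inv_mul
      rw [← hw] at hrel
      linear_combination (↑w⁻¹ : ℤ_[p]) * hrel -
        (∑ i ∈ Finset.range m, (a i : ℤ_[p]) * z i) * hw1
    obtain ⟨y'', hy''⟩ := dvd_unitProd_mul_of_padic hc hcb hsz
    have hyy : y' = ((-y'' : ℤ) : ℤ_[p]) := by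
      have hc0 : (c : ℤ_[p]) ≠ 0 := by exact_mod_cast hc
      refine mul_left_cancel₀ hc0 ?_
      rw [hsum, hy''] at hrel
      push_cast at hrel ⊢
      linear_combination hrel
    refine ⟨-y'', ?_, by rwa [← hyy]⟩
    have e1 := hbound a ha
    rw [hy'', abs_mul] at e1
    have e3 : 1 ≤ |c| := Int.one_le_abs hc
    rw [abs_neg]
    have e4 : b * Q * S ≤ p ^ b * (b * Q * S + 2) :=
      (Nat.le_add_right _ 2).trans (Nat.le_mul_of_pos_left _ hp1)
    have e5 : ((b * Q * S : ℕ) : ℤ) ≤ (p ^ b * (b * Q * S + 2) : ℕ) := by exact_mod_cast e4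
    refine le_trans ?_ e5
    push_cast
    exact (le_mul_of_one_le_left (abs_nonneg y'') e3).trans e1

end BackAndForth

end TreePres

namespace TreePres

open FirstOrder FirstOrder.Language
open Encodable (encode)

/-! ### Terms in the signature of additive groups -/

section Terms

variable {α : Type}

/-- The term `0`. -/
def zeroTerm : addGroupLang.Term α :=
  .func (l := 0) (AddGroupFunc.zero : addGroupLang.Functions 0) ![]

/-- The term `-t`. -/
def negTerm (t : addGroupLang.Term α) : addGroupLang.Term α :=
  .func (l := 1) (AddGroupFunc.neg : addGroupLang.Functions 1) ![t]

/-- The term `s + t`. -/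
def addTerm (s t : addGroupLang.Term α) : addGroupLang.Term α :=
  .func (l := 2) (AddGroupFunc.add : addGroupLang.Functions 2) ![s, t]

theorem term_induction {P : addGroupLang.Term α → Prop} (var : ∀ a, P (.var a)) (zero : P zeroTerm)
    (neg : ∀ t, P t → P (negTerm t)) (add : ∀ s t, P s → P t → P (addTerm s t)) (t) : P t := by
  induction t with
  | var a => exact var a
  | @func l f ts ih =>
    change AddGroupFunc l at f
    cases f with
    | zero =>
      have : ts = ![] := Subsingleton.elim _ _
      rw [this]
      exact zero
    | neg =>
      have : ts = ![ts 0] := by ext i; fin_cases i; rfl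
      rw [this]
      exact neg _ (ih 0)
    | add =>
      have : ts = ![ts 0, ts 1] := by ext i; fin_cases i <;> rfl
      rw [this]
      exact add _ _ (ih 0) (ih 1)

theorem termCode_zeroTerm (v : α → ℕ) : termCode v zeroTerm = zeroCode := by
  simp [zeroTerm, termCode, zeroCode, SymbolCoding.code, addGroupSymbolCode]

theorem termCode_negTerm (v : α → ℕ) (t) : termCode v (negTerm t) = negCode (termCode v t) := by
  simp [negTerm, termCode, negCode, SymbolCoding.code, addGroupSymbolCode]

theorem termCode_addTerm (v : α → ℕ) (s t) :
    termCode v (addTerm s t) = addCode (termCode v s) (termCode v t) := by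
  simp [addTerm, termCode, addCode, SymbolCoding.code, addGroupSymbolCode]

section Realize

variable {A : Type} [Zero A] [Neg A] [Add A] (v : α → A)

theorem realize_zeroTerm : (zeroTerm : addGroupLang.Term α).realize v = 0 := rfl

theorem realize_negTerm (t : addGroupLang.Term α) : (negTerm t).realize v = -t.realize v := rfl

theorem realize_addTerm (s t : addGroupLang.Term α) :
    (addTerm s t).realize v = s.realize v + t.realize v := rfl

end Realize

/-- Needed to recover an equation from its number when that number appears in the positive atomic
diagram. -/
theorem termCode_injective {v : α → ℕ} (hv : Function.Injective v) :
    Function.Injective (termCode v : addGroupLang.Term α → ℕ) := by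
  intro s
  induction s using term_induction with
  | var a =>
    intro t h
    induction t using term_induction with
    | var b => simp only [termCode, Nat.pair_eq_pair, true_and] at h; rw [hv h]
    | zero => simp [termCode_zeroTerm, termCode, zeroCode] at h
    | neg t => simp [termCode_negTerm, termCode, negCode] at h
    | add t t' => simp [termCode_addTerm, termCode, addCode] at h
  | zero =>
    intro t h
    induction t using term_induction with
    | var b => simp [termCode_zeroTerm, termCode, zeroCode] at h
    | zero => rfl
    | neg t => simp [termCode_zeroTerm, termCode_negTerm, zeroCode, negCode] at h
    | add t t' => simp [termCode_zeroTerm, termCode_addTerm, zeroCode, addCode] at h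
  | neg s ih =>
    intro t h
    induction t using term_induction with
    | var b => simp [termCode_negTerm, termCode, negCode] at h
    | zero => simp [termCode_zeroTerm, termCode_negTerm, zeroCode, negCode] at h
    | neg t =>
      simp only [termCode_negTerm, negCode, Nat.pair_eq_pair, true_and, Encodable.encode_inj,
        List.cons.injEq, and_true] at h
      rw [ih h]
    | add t t' => simp [termCode_negTerm, termCode_addTerm, negCode, addCode] at h
  | add s s' ih ih' =>
    intro t h
    induction t using term_induction with
    | var b => simp [termCode_addTerm, termCode, addCode] at h
    | zero => simp [termCode_zeroTerm, termCode_addTerm, zeroCode, addCode] at h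
    | neg t => simp [termCode_negTerm, termCode_addTerm, negCode, addCode] at h
    | add t t' =>
      simp only [termCode_addTerm, addCode, Nat.pair_eq_pair, true_and, Encodable.encode_inj,
        List.cons.injEq, and_true] at h
      rw [ih h.1, ih' h.2]

theorem varCode_injective {n k : ℕ} : Function.Injective (varCode : Fin n ⊕ Fin k → ℕ) := by
  rintro (i | i) (j | j) h <;> simp only [varCode] at h
  · exact congrArg _ (Fin.ext (by omega))
  · omega
  · omega
  · exact congrArg _ (Fin.ext (by omega))

theorem le_negCode (a : ℕ) : a + 1 ≤ negCode a := by
  have h1 := Nat.add_le_pair 1 (Nat.pair 1 (Nat.pair 1 (encode [a])))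
  have h2 := Nat.right_le_pair 1 (Nat.pair 1 (encode [a]))
  have h3 := Nat.right_le_pair 1 (encode [a])
  have h4 : a ≤ encode [a] := by
    rw [Encodable.encode_list_cons]
    exact (Nat.left_le_pair _ _).trans (Nat.le_succ _)
  rw [negCode]
  omega

theorem add_le_addCode (a b : ℕ) : a + b + 1 ≤ addCode a b := by
  have h1 := Nat.add_le_pair 1 (Nat.pair 2 (Nat.pair 2 (encode [a, b])))
  have h2 := Nat.right_le_pair 2 (Nat.pair 2 (encode [a, b]))
  have h3 := Nat.right_le_pair 2 (encode [a, b])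
  have h4 : a + b ≤ encode [a, b] := by
    rw [Encodable.encode_list_cons, Encodable.encode_list_cons]
    have h5 := Nat.add_le_pair a (Nat.pair b (encode ([] : List ℕ))).succ
    have h6 := Nat.left_le_pair b (encode ([] : List ℕ))
    simp only [Encodable.encode_nat] at *
    omega
  rw [addCode]
  omega

/-- The supremum of the weights of the variables of a term. -/
def termBound (w : α → ℕ) : addGroupLang.Term α → ℕ
  | .var a => w a
  | .func _ ts => Finset.univ.sup fun i => termBound w (ts i)

theorem termBound_zeroTerm (w : α → ℕ) : termBound w zeroTerm = 0 := by
  simp [zeroTerm, termBound]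

theorem termBound_negTerm (w : α → ℕ) (t) : termBound w (negTerm t) = termBound w t := by
  simp [negTerm, termBound]

theorem termBound_addTerm (w : α → ℕ) (s t) :
    termBound w (addTerm s t) = max (termBound w s) (termBound w t) := by
  simp [addTerm, termBound, Fin.univ_succ]

theorem termBound_le {w : α → ℕ} {n : ℕ} (hw : ∀ a, w a ≤ n) (t : addGroupLang.Term α) :
    termBound w t ≤ n := by
  induction t using term_induction with
  | var a => exact hw a
  | zero => simp [termBound_zeroTerm]
  | neg t ih => rwa [termBound_negTerm]
  | add s t ih ih' => rw [termBound_addTerm]; exact max_le ih ih'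

end Terms

/-! ### The free variables of a formula -/

/-- A free variable `xᵢ` has the weight `i + 1`, a bound variable the weight `0`. -/
def freeWeight {n k : ℕ} : Fin n ⊕ Fin k → ℕ := Sum.elim (fun i => i.val + 1) fun _ => 0

/-- The least `r` such that all free variables of the formula are among `x₀, …, xᵣ₋₁`. -/
def freeBound {n : ℕ} : {k : ℕ} → addGroupLang.BoundedFormula (Fin n) k → ℕ
  | _, .falsum => 0
  | _, .equal s t => max (termBound freeWeight s) (termBound freeWeight t)
  | _, .rel _ _ => 0
  | _, .imp φ ψ => max (freeBound φ) (freeBound ψ)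
  | _, .all φ => freeBound φ

/-- The functional is not told `n`. It works with this computable bound instead, which never exceeds
`n`, so that all the equations it waits for are about paths that are really present. -/
theorem freeBound_le {n k : ℕ} (φ : addGroupLang.BoundedFormula (Fin n) k) :
    freeBound φ ≤ n := by
  have h : ∀ {k : ℕ} (a : Fin n ⊕ Fin k), freeWeight a ≤ n := by
    rintro k (i | i) <;> simp [freeWeight]
  induction φ with
  | falsum => exact Nat.zero_le _
  | equal s t => exact max_le (termBound_le h s) (termBound_le h t)
  | rel R _ => exact isEmptyElim R
  | imp φ ψ ih ih' => exact max_le ih ih'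
  | all φ ih => exact ih

theorem exists_partrec_freeBound : ∃ F : ℕ → Part ℕ, Partrec (fun c => F c : ℕ →. ℕ) ∧
    ∀ {n k : ℕ} (φ : addGroupLang.BoundedFormula (Fin n) k),
      F (formulaCode φ) = Part.some (freeBound φ) := by
  obtain ⟨T, hT, Tvar, Tzero, Tneg, Tadd⟩ := exists_partrec_termRec (E := Unit)
    (V := fun _ v => if v % 2 = 0 then v / 2 + 1 else 0) (Z := 0) (Ng := fun a => a) (Ad := max)
    (Primrec.ite (primrecPred_eq (Primrec.nat_mod.comp Primrec.snd (Primrec.const 2))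
      (Primrec.const 0)) (Primrec.succ.comp (Primrec.nat_div.comp Primrec.snd (Primrec.const 2)))
      (Primrec.const 0)).to₂ Primrec.id Primrec.nat_max
  have hTt : ∀ {n k : ℕ} (t : addGroupLang.Term (Fin n ⊕ Fin k)),
      T () (termCode varCode t) = Part.some (termBound freeWeight t) := by
    intro n k t
    induction t using term_induction with
    | var a =>
      rcases a with i | i
      · simp [termCode, Tvar, varCode, termBound, freeWeight]
      · simp [termCode, Tvar, varCode, termBound, freeWeight]
    | zero => simp [termCode_zeroTerm, Tzero, termBound_zeroTerm]
    | neg t ih => simp [termCode_negTerm, Tneg, ih, termBound_negTerm]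
    | add s t ih ih' => simp [termCode_addTerm, Tadd, ih, ih', termBound_addTerm]
  -- With `H = 1` and `ini = 0`, the quantifier clause takes one `max` with `0` and so passes on the
  -- value of the body.
  obtain ⟨F, hF, Ffal, Feq, Fimp, Fall⟩ := exists_partrec_formulaRec (E := Unit) (fal := 0)
    (ini := 0) (EQ := fun e a b => (T e a).bind fun x => (T e b).map (max x)) (IMP := max)
    (STEP := max) (H := fun _ _ => 1) (EXT := fun _ => ())
    (((hT.comp Computable.fst (Computable.fst.comp Computable.snd)).bind
      ((hT.comp (Computable.fst.comp Computable.fst)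
        ((Computable.snd.comp Computable.snd).comp Computable.fst)).map
        (Primrec.nat_max.to_comp.comp (Computable.snd.comp Computable.fst)
          Computable.snd).to₂).to₂)) Primrec.nat_max Primrec.nat_max (Primrec₂.const 1)
    (Primrec.const ())
  refine ⟨F (), hF.comp (Computable.const ()) Computable.id, fun φ => ?_⟩
  induction φ with
  | falsum => exact Ffal ()
  | equal s t => simp [formulaCode, Feq, hTt, freeBound]
  | rel R _ => exact isEmptyElim R
  | imp φ ψ ih ih' => simp [formulaCode, Fimp, ih, ih', freeBound]
  | all φ ih => simp [formulaCode, Fall, ih, freeBound]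

/-! ### Integers, coded as differences -/

/-- The integer with the code `e`. -/
def intOf (e : ℕ) : ℤ := e.unpair.1 - e.unpair.2

/-- Multiplication by a natural number, on codes. -/
def scaleCode (q e : ℕ) : ℕ := Nat.pair (q * e.unpair.1) (q * e.unpair.2)

theorem intOf_scaleCode (q e : ℕ) : intOf (scaleCode q e) = q * intOf e := by
  simp [intOf, scaleCode, mul_sub]

theorem abs_intOf_le (e : ℕ) : |intOf e| ≤ e := by
  have h := Nat.add_le_pair e.unpair.1 e.unpair.2
  rw [Nat.pair_unpair] at h
  rw [intOf, abs_le]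
  omega

theorem exists_intOf_eq {y : ℤ} {h : ℕ} (hy : |y| ≤ h) : ∃ e < (h + 1) ^ 2, intOf e = y := by
  rw [abs_le] at hy
  refine ⟨Nat.pair y.toNat (-y).toNat, (Nat.pair_lt_max_add_one_sq _ _).trans_le ?_, ?_⟩
  · exact Nat.pow_le_pow_left (Nat.succ_le_succ (max_le (by omega) (by omega))) 2
  · simp [intOf]

/-- The `i`-th entry of a list of coded integers. -/
def entry (l : List ℕ) (i : ℕ) : ℤ := intOf (l.getD i 0)

/-- A computable value for the size `S` in `Sim.exists_extend_int`: the sum of the codes dominates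
the sum of the absolute values. -/
theorem sum_abs_entry_le (l : List ℕ) :
    ∑ i ∈ Finset.range l.length, |entry l i| ≤ (l.sum : ℕ) := by
  induction l with
  | nil => simp
  | cons e l ih =>
    rw [List.length_cons, Finset.sum_range_succ']
    have := abs_intOf_le e
    simp only [entry, List.getD_cons_succ, List.getD_cons_zero, List.sum_cons, Nat.cast_add] at ih ⊢
    linarith

theorem entry_extend {l : List ℕ} {q e i : ℕ} (hi : i ≤ l.length) :
    entry (l.map (scaleCode q) ++ [e]) i =
      Function.update (fun i => (q : ℤ) * entry l i) l.length (intOf e) i := by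
  rcases hi.lt_or_eq with hi | rfl
  · rw [Function.update_of_ne hi.ne]
    simp only [entry]
    rw [← intOf_scaleCode]
    simp [List.getElem?_append, hi]
  · simp [entry]

/-! ### Bounds -/

/-- A bound for the coefficients that matter to the formula with Gödel number `c`. -/
def coeffBound (c : ℕ) : ℕ := (fun b => 2 * b ^ 2)^[c] (c + 1)

theorem le_two_mul_sq (b : ℕ) : b ≤ 2 * b ^ 2 := by
  nlinarith [Nat.le_self_pow two_ne_zero b]

theorem le_coeffBound (c : ℕ) : c + 1 ≤ coeffBound c :=
  Function.id_le_iterate_of_id_le le_two_mul_sq c (c + 1)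

/-- A subformula has a smaller Gödel number, and one more iteration of `b ↦ 2 * b ^ 2` pays for one
back-and-forth step. The Gödel number thus bounds both the quantifier depth and the coefficients. -/
theorem two_mul_coeffBound_sq_le {c d : ℕ} (h : c < d) :
    2 * coeffBound c ^ 2 ≤ coeffBound d := by
  have hm : Monotone fun b : ℕ => 2 * b ^ 2 := fun a b hab =>
    Nat.mul_le_mul_left 2 (Nat.pow_le_pow_left hab 2)
  calc 2 * coeffBound c ^ 2 = (fun b => 2 * b ^ 2)^[c + 1] (c + 1) := by
        rw [Function.iterate_succ_apply', coeffBound]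
    _ ≤ (fun b => 2 * b ^ 2)^[c + 1] (d + 1) := hm.iterate _ (by omega)
    _ ≤ (fun b => 2 * b ^ 2)^[d] (d + 1) :=
        Function.monotone_iterate_of_id_le le_two_mul_sq h (d + 1)

theorem coeffBound_le {c d : ℕ} (h : c ≤ d) : coeffBound c ≤ coeffBound d := by
  rcases h.lt_or_eq with h | rfl
  · exact (le_two_mul_sq _).trans (two_mul_coeffBound_sq_le h)
  · exact le_rfl

theorem primrec_coeffBound : Primrec coeffBound :=
  Primrec.nat_iterate Primrec.id Primrec.succ
    (Primrec.nat_mul.comp (Primrec.const 2)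
      (primrec_pow Primrec.snd (Primrec.const 2))).to₂

theorem primrec_unitProd (p : ℕ) : Primrec (unitProd p) :=
  primrec_prod_range Primrec.succ (Primrec.ite
    (primrecPred_eq (Primrec.nat_mod.comp Primrec.snd (Primrec.const p)) (Primrec.const 0))
    (Primrec.const 1) Primrec.snd).to₂

theorem primrec_list_sum : Primrec (List.sum : List ℕ → ℕ) :=
  (Primrec.list_foldr Primrec.id (Primrec.const 0)
    (Primrec.nat_add.comp (Primrec.fst.comp Primrec.snd)
      (Primrec.snd.comp Primrec.snd)).to₂).of_eq fun l => by
    rw [List.sum_eq_foldr]; rfl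

theorem primrec_scaleCode : Primrec₂ scaleCode :=
  Primrec₂.natPair.comp (Primrec.nat_mul.comp Primrec.fst (primrec_fst Primrec.snd))
    (Primrec.nat_mul.comp Primrec.fst (primrec_snd Primrec.snd))

/-- A bound for the codes of the integers over which a quantifier has to range. -/
def quantBound (p : ℕ) (l : List ℕ) (c : ℕ) : ℕ :=
  (p ^ coeffBound c * (coeffBound c * unitProd p (coeffBound c) * l.sum + 2) + 1) ^ 2

theorem primrec_quantBound (p : ℕ) : Primrec₂ (quantBound p) := by
  have hb : Primrec fun q : List ℕ × ℕ => coeffBound q.2 := primrec_coeffBound.comp Primrec.snd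
  have h1 : Primrec fun q : List ℕ × ℕ => coeffBound q.2 * unitProd p (coeffBound q.2) :=
    Primrec.nat_mul.comp hb ((primrec_unitProd p).comp hb)
  have h2 : Primrec fun q : List ℕ × ℕ =>
      coeffBound q.2 * unitProd p (coeffBound q.2) * q.1.sum + 2 :=
    Primrec.nat_add.comp (Primrec.nat_mul.comp h1 (primrec_list_sum.comp Primrec.fst))
      (Primrec.const 2)
  have h3 : Primrec fun q : List ℕ × ℕ => p ^ coeffBound q.2 :=
    primrec_pow (Primrec.const p) hb
  have h4 : Primrec fun q : List ℕ × ℕ => p ^ coeffBound q.2 *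
      (coeffBound q.2 * unitProd p (coeffBound q.2) * q.1.sum + 2) + 1 :=
    Primrec.succ.comp (Primrec.nat_mul.comp h3 h2)
  exact primrec_pow h4 (Primrec.const 2)

/-- The tuples over which a quantifier has to range. -/
def extendList (p : ℕ) (l : List ℕ) (c e : ℕ) : List ℕ :=
  l.map (scaleCode (unitProd p (coeffBound c))) ++ [e]

theorem primrec_extendList (p : ℕ) :
    Primrec fun q : List ℕ × ℕ × ℕ => extendList p q.1 q.2.1 q.2.2 := by
  have h1 : Primrec fun q : (List ℕ × ℕ × ℕ) × ℕ => q.1.2.1 :=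
    Primrec.fst.comp (Primrec.snd.comp Primrec.fst)
  have h2 : Primrec fun q : (List ℕ × ℕ × ℕ) × ℕ => unitProd p (coeffBound q.1.2.1) :=
    (primrec_unitProd p).comp (primrec_coeffBound.comp h1)
  have h3 : Primrec fun q : (List ℕ × ℕ × ℕ) × ℕ =>
      scaleCode (unitProd p (coeffBound q.1.2.1)) q.2 :=
    primrec_scaleCode.comp h2 Primrec.snd
  exact Primrec.list_concat.comp (Primrec.list_map Primrec.fst h3.to₂)
    (Primrec.snd.comp Primrec.snd)

/-! ### Evaluation of formulas at integral tuples -/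

/-- The place of a variable in a tuple that lists `r` free variables and then the bound ones. -/
def place (r v : ℕ) : ℕ := if v % 2 = 0 then v / 2 else r + v / 2

theorem place_two_mul (r i : ℕ) : place r (2 * i) = i := by
  rw [place, if_pos (by omega)]
  omega

theorem place_two_mul_add_one (r i : ℕ) : place r (2 * i + 1) = r + i := by
  rw [place, if_neg (by omega)]
  omega

/-- Addition of coded integers. -/
def addInt (x y : ℕ) : ℕ := Nat.pair (x.unpair.1 + y.unpair.1) (x.unpair.2 + y.unpair.2)

theorem intOf_addInt (x y : ℕ) : intOf (addInt x y) = intOf x + intOf y := by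
  simp [intOf, addInt]; ring

/-- Negation of coded integers. -/
def negInt (x : ℕ) : ℕ := Nat.pair x.unpair.2 x.unpair.1

theorem intOf_negInt (x : ℕ) : intOf (negInt x) = -intOf x := by
  simp [intOf, negInt]

theorem intOf_eq_intOf {x y : ℕ} :
    x.unpair.1 + y.unpair.2 = y.unpair.1 + x.unpair.2 ↔ intOf x = intOf y := by
  simp only [intOf]; omega

/-- `f` gives the tuple of values of the free variables `xᵢ`, `i < r`, and of the bound ones. -/
def Lists {A : Type} (r : ℕ) {n k : ℕ} (f : ℕ → A) (v : Fin n → A) (xs : Fin k → A) : Prop :=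
  (∀ i : Fin n, i.val < r → f i = v i) ∧ ∀ j : Fin k, f (r + j) = xs j

theorem Lists.snoc {A : Type} {r n k : ℕ} {f : ℕ → A} {v : Fin n → A} {xs : Fin k → A}
    (h : Lists r f v xs) (y : A) :
    Lists r (Function.update f (r + k) y) v (Fin.snoc xs y : Fin (k + 1) → A) := by
  refine ⟨fun i hi => ?_, fun j => ?_⟩
  · rw [Function.update_of_ne (by omega), h.1 i hi]
  · refine Fin.lastCases ?_ (fun j => ?_) j
    · simp
    · rw [Fin.snoc_castSucc, Function.update_of_ne (by simp [j.2.ne]), ← h.2 j]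
      rfl

/-- The value of a term is a linear form with small coefficients. -/
theorem exists_linear_form {n k r : ℕ} (t : addGroupLang.Term (Fin n ⊕ Fin k))
    (ht : termBound freeWeight t ≤ r) {T : List ℕ → ℕ → Part ℕ}
    (Tvar : ∀ l v, T l (Nat.pair 0 v) = Part.some (l.getD (place r v) 0))
    (Tzero : ∀ l, T l zeroCode = Part.some 0)
    (Tneg : ∀ l a, T l (negCode a) = (T l a).map negInt)
    (Tadd : ∀ l a b, T l (addCode a b) = (T l a).bind fun x => (T l b).map (addInt x)) :
    ∃ a : ℕ → ℤ, (∀ i, |a i| ≤ termCode varCode t + 1) ∧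
      (∀ l, ∃ e, T l (termCode varCode t) = Part.some e ∧
        intOf e = ∑ i ∈ Finset.range (r + k), a i * entry l i) ∧
      ∀ (A : Type) [CommRing A] (f : ℕ → A) (v : Fin n → A) (xs : Fin k → A),
        Lists r f v xs →
          t.realize (Sum.elim v xs) = ∑ i ∈ Finset.range (r + k), (a i : A) * f i := by
  induction t using term_induction with
  | var s =>
    have hs : place r (varCode s) < r + k := by
      rcases s with i | j
      · simp only [termBound, freeWeight, Sum.elim_inl] at ht
        simp only [varCode, place_two_mul]
        omega
      · simp only [varCode, place_two_mul_add_one]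
        omega
    -- The bound needs its `+ 1` here: the variable `x₀` has the code `Nat.pair 0 0 = 0` but the
    -- coefficient `1`.
    refine ⟨Pi.single (place r (varCode s)) 1, fun i => ?_, fun l => ⟨_, Tvar l _, ?_⟩,
      fun A _ f v xs h => ?_⟩
    · rw [Pi.single_apply]
      split_ifs
      · simp
      · simp; positivity
    · rw [Finset.sum_eq_single_of_mem _ (Finset.mem_range.2 hs)]
      · simp [entry]
      · intro i _ hi
        simp [hi]
    · rw [Finset.sum_eq_single_of_mem _ (Finset.mem_range.2 hs)]
      · rcases s with i | j
        · simp only [termBound, freeWeight, Sum.elim_inl] at ht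
          simp [place_two_mul, varCode, h.1 i ht]
        · simp [place_two_mul_add_one, varCode, h.2 j]
      · intro i _ hi
        simp [hi]
  | zero =>
    refine ⟨0, fun i => by simp; positivity, fun l => ⟨0, ?_, ?_⟩, fun A _ f v xs h => ?_⟩
    · rw [termCode_zeroTerm, Tzero]
    · simp [intOf]
    · simp [realize_zeroTerm]
  | neg t ih =>
    rw [termBound_negTerm] at ht
    obtain ⟨a, ha, hT, hr⟩ := ih ht
    refine ⟨-a, fun i => ?_, fun l => ?_, fun A _ f v xs h => ?_⟩
    · have := le_negCode (termCode varCode t)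
      rw [Pi.neg_apply, abs_neg, termCode_negTerm]
      exact (ha i).trans (by exact_mod_cast this.trans (Nat.le_succ _))
    · obtain ⟨e, he, hs⟩ := hT l
      exact ⟨negInt e, by rw [termCode_negTerm, Tneg, he, Part.map_some],
        by rw [intOf_negInt, hs]; simp⟩
    · rw [realize_negTerm, hr A f v xs h]
      simp
  | add s t ih ih' =>
    rw [termBound_addTerm] at ht
    obtain ⟨a, ha, hT, hr⟩ := ih ((le_max_left _ _).trans ht)
    obtain ⟨a', ha', hT', hr'⟩ := ih' ((le_max_right _ _).trans ht)
    refine ⟨a + a', fun i => ?_, fun l => ?_, fun A _ f v xs h => ?_⟩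
    · have h1 := add_le_addCode (termCode varCode s) (termCode varCode t)
      have h2 := abs_add_le (a i) (a' i)
      have h3 := ha i
      have h4 := ha' i
      rw [Pi.add_apply, termCode_addTerm]
      zify at h1
      linarith
    · obtain ⟨e, he, hs⟩ := hT l
      obtain ⟨e', he', hs'⟩ := hT' l
      refine ⟨addInt e e', by rw [termCode_addTerm, Tadd, he, he', Part.bind_some, Part.map_some],
        ?_⟩
      rw [intOf_addInt, hs, hs']
      simp [add_mul, Finset.sum_add_distrib]
    · rw [realize_addTerm, hr A f v xs h, hr' A f v xs h]
      simp [add_mul, Finset.sum_add_distrib]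

-- A bounded universal quantifier is a product of truth values.
open Classical in
theorem rec_mul_indicator {G : ℕ → Part ℕ} {P : ℕ → Prop} {H : ℕ}
    (h : ∀ i < H, G i = Part.some (if P i then 1 else 0)) :
    Nat.rec (motive := fun _ => Part ℕ) (Part.some 1)
      (fun i IH => IH.bind fun acc => (G i).map (acc * ·)) H =
        Part.some (if ∀ i < H, P i then 1 else 0) := by
  induction H with
  | zero => simp
  | succ k ih =>
    have := ih fun i hi => h i (by omega)
    simp only [this, h k (by omega), Part.bind_some, Part.map_some]
    congr 1
    by_cases h1 : ∀ i < k, P i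
    · by_cases h2 : P k
      · have h3 : ∀ i < k + 1, P i := fun i hi => by
          rcases Nat.lt_succ_iff_lt_or_eq.1 hi with hi | rfl
          · exact h1 i hi
          · exact h2
        rw [if_pos h1, if_pos h2, if_pos h3]
      · have h3 : ¬ ∀ i < k + 1, P i := fun h3 => h2 (h3 k (by omega))
        rw [if_neg h2, if_neg h3, mul_zero]
    · have h3 : ¬ ∀ i < k + 1, P i := fun h3 => h1 fun i hi => h3 i (by omega)
      rw [if_neg h1, if_neg h3, zero_mul]

theorem Sim.entry_congr {p : ℕ} [Fact p.Prime] {b m : ℕ} {x : ℕ → ℤ_[p]} {z : ℕ → ℤ} {l : List ℕ}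
    (h : Sim b m x fun i => (z i : ℤ_[p])) (hl : ∀ i < m, entry l i = z i) :
    Sim b m x fun i => (entry l i : ℤ_[p]) :=
  h.congr (fun _ _ => rfl) fun i hi => by rw [hl i hi]

theorem exists_partrec_intTerm : ∃ T : ℕ × List ℕ → ℕ → Part ℕ,
    Partrec₂ (fun e t => T e t : ℕ × List ℕ → ℕ →. ℕ) ∧
    (∀ e v, T e (Nat.pair 0 v) = Part.some (e.2.getD (place e.1 v) 0)) ∧
    (∀ e, T e zeroCode = Part.some 0) ∧ (∀ e a, T e (negCode a) = (T e a).map negInt) ∧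
    ∀ e a b, T e (addCode a b) = (T e a).bind fun x => (T e b).map (addInt x) := by
  have h1 : Primrec fun q : (ℕ × List ℕ) × ℕ => place q.1.1 q.2 :=
    Primrec.ite (primrecPred_eq (Primrec.nat_mod.comp Primrec.snd (Primrec.const 2))
      (Primrec.const 0)) (Primrec.nat_div.comp Primrec.snd (Primrec.const 2))
      (Primrec.nat_add.comp (Primrec.fst.comp Primrec.fst)
        (Primrec.nat_div.comp Primrec.snd (Primrec.const 2)))
  have h2 : Primrec₂ fun (e : ℕ × List ℕ) (v : ℕ) => e.2.getD (place e.1 v) 0 :=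
    (Primrec.list_getD 0).comp (Primrec.snd.comp Primrec.fst) h1
  have h3 : Primrec negInt :=
    Primrec₂.natPair.comp (primrec_snd Primrec.id) (primrec_fst Primrec.id)
  have h4 : Primrec₂ addInt := Primrec₂.natPair.comp
    (Primrec.nat_add.comp (primrec_fst Primrec.fst) (primrec_fst Primrec.snd))
    (Primrec.nat_add.comp (primrec_snd Primrec.fst) (primrec_snd Primrec.snd))
  exact exists_partrec_termRec h2 h3 h4

/-- Equality of coded integers, as a truth value. -/
def eqInt (x y : ℕ) : ℕ := if x.unpair.1 + y.unpair.2 = y.unpair.1 + x.unpair.2 then 1 else 0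

theorem primrec_eqInt : Primrec₂ eqInt :=
  Primrec.ite (primrecPred_eq
    (Primrec.nat_add.comp (primrec_fst Primrec.fst) (primrec_snd Primrec.snd))
    (Primrec.nat_add.comp (primrec_fst Primrec.snd) (primrec_snd Primrec.fst)))
    (Primrec.const 1) (Primrec.const 0)

open Classical in
theorem eqInt_eq (x y : ℕ) : eqInt x y = if intOf x = intOf y then 1 else 0 :=
  if_congr intOf_eq_intOf rfl rfl

theorem partrec_bind_map {E : Type} [Primcodable E] {T : E → ℕ → Part ℕ} {f : ℕ → ℕ → ℕ}
    (hT : Partrec₂ (fun e t => T e t : E → ℕ →. ℕ)) (hf : Primrec₂ f) :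
    Partrec fun q : E × ℕ × ℕ => (T q.1 q.2.1).bind fun x => (T q.1 q.2.2).map (f x) :=
  (hT.comp Computable.fst (Computable.fst.comp Computable.snd)).bind
    ((hT.comp (Computable.fst.comp Computable.fst)
      ((Computable.snd.comp Computable.snd).comp Computable.fst)).map
      (hf.to_comp.comp (Computable.snd.comp Computable.fst) Computable.snd).to₂).to₂

/-- The truth definition for quantifiers with a bounded range. The tuple is rescaled at each
quantifier, as `Sim.exists_extend_int` requires. -/
theorem exists_partrec_boundedTruth (p : ℕ) {T : ℕ × List ℕ → ℕ → Part ℕ}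
    (hT : Partrec₂ (fun e t => T e t : ℕ × List ℕ → ℕ →. ℕ)) :
    ∃ F : ℕ × List ℕ → ℕ → Part ℕ, Partrec₂ (fun e c => F e c : ℕ × List ℕ → ℕ →. ℕ) ∧
      (∀ e, F e (Nat.pair 0 0) = Part.some 0) ∧
      (∀ e a b, F e (Nat.pair 1 (Nat.pair a b)) =
        (T e a).bind fun x => (T e b).map (eqInt x)) ∧
      (∀ e a b, F e (Nat.pair 2 (Nat.pair a b)) =
        (F e a).bind fun x => (F e b).map fun y => if x = 0 then 1 else y) ∧
      ∀ e a, F e (Nat.pair 3 a) = Nat.rec (motive := fun _ => Part ℕ) (Part.some 1)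
        (fun i IH => IH.bind fun acc => (F (e.1, extendList p e.2 a i) a).map (acc * ·))
        (quantBound p e.2 a) := by
  have hext : Primrec fun q : (ℕ × List ℕ) × ℕ × ℕ =>
      (q.1.1, extendList p q.1.2 q.2.1 q.2.2) := by
    have h1 : Primrec fun q : (ℕ × List ℕ) × ℕ × ℕ => q.1.1 := Primrec.fst.comp Primrec.fst
    have h2 : Primrec fun q : (ℕ × List ℕ) × ℕ × ℕ => q.1.2 := Primrec.snd.comp Primrec.fst
    have h3 : Primrec fun q : (ℕ × List ℕ) × ℕ × ℕ => extendList p q.1.2 q.2.1 q.2.2 :=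
      Primrec.comp (g := fun q : (ℕ × List ℕ) × ℕ × ℕ => (q.1.2, q.2)) (primrec_extendList p)
        (h2.pair Primrec.snd)
    exact h1.pair h3
  have hqb : Primrec₂ fun (e : ℕ × List ℕ) (c : ℕ) => quantBound p e.2 c :=
    (primrec_quantBound p).comp (Primrec.snd.comp Primrec.fst) Primrec.snd
  have himp : Primrec₂ fun x y : ℕ => if x = 0 then 1 else y :=
    Primrec.ite (primrecPred_eq Primrec.fst (Primrec.const 0)) (Primrec.const 1) Primrec.snd
  exact exists_partrec_formulaRec (partrec_bind_map hT primrec_eqInt) himp Primrec.nat_mul hqb hext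

open Classical in
/-- Truth in `ℤ_[p]` is computed by quantifiers that range over finitely many integers. -/
theorem exists_partrec_realize (p : ℕ) [Fact p.Prime] : ∃ F : ℕ × List ℕ → ℕ → Part ℕ,
    Partrec₂ (fun e c => F e c : ℕ × List ℕ → ℕ →. ℕ) ∧
    ∀ {n k r : ℕ} (φ : addGroupLang.BoundedFormula (Fin n) k) (l : List ℕ) (x : ℕ → ℤ_[p])
      (v : Fin n → ℤ_[p]) (xs : Fin k → ℤ_[p]), freeBound φ ≤ r →
      l.length = r + k → Lists r x v xs →
      Sim (coeffBound (formulaCode φ)) (r + k) x (fun i => (entry l i : ℤ_[p])) →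
      F (r, l) (formulaCode φ) = Part.some (if φ.Realize v xs then 1 else 0) := by
  obtain ⟨T, hT, Tvar, Tzero, Tneg, Tadd⟩ := exists_partrec_intTerm
  obtain ⟨F, hF, Ffal, Feq, Fimp, Fall⟩ := exists_partrec_boundedTruth p hT
  refine ⟨F, hF, fun {n k r} φ => ?_⟩
  induction φ with
  | falsum =>
    intro l x v xs _ _ _ _
    exact (Ffal _).trans (by simp [BoundedFormula.Realize])
  | @equal k s t =>
    intro l x v xs hr hl hx hsim
    rw [freeBound, max_le_iff] at hr
    obtain ⟨a, ha, haT, hav⟩ := exists_linear_form s hr.1 (T := fun l => T (r, l))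
      (fun l => Tvar (r, l)) (fun l => Tzero (r, l)) (fun l => Tneg (r, l)) fun l => Tadd (r, l)
    obtain ⟨a', ha', haT', hav'⟩ := exists_linear_form t hr.2 (T := fun l => T (r, l))
      (fun l => Tvar (r, l)) (fun l => Tzero (r, l)) (fun l => Tneg (r, l)) fun l => Tadd (r, l)
    obtain ⟨e, he, hs⟩ := haT l
    obtain ⟨e', he', hs'⟩ := haT' l
    rw [formulaCode, Feq, he, he', Part.bind_some, Part.map_some]
    -- The equation becomes a single relation. Its coefficients are at most the sum of the two term
    -- codes plus `2`, hence at most the code of the equation plus `1`.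
    have key := hsim.1 (fun i => a i - a' i) fun i => by
      have h1 := abs_sub (a i) (a' i)
      have h2 := le_coeffBound (formulaCode (BoundedFormula.equal s t))
      have h3 := Nat.add_le_pair 1 (Nat.pair (termCode varCode s) (termCode varCode t))
      have h4 := Nat.add_le_pair (termCode varCode s) (termCode varCode t)
      have h5 := ha i
      have h6 := ha' i
      rw [formulaCode] at h2 ⊢
      zify at h2 h3 h4
      linarith
    have hiff : (BoundedFormula.equal s t).Realize v xs ↔
        intOf e = intOf e' := by
      rw [hs, hs', BoundedFormula.Realize, hav ℤ_[p] x v xs hx,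
        hav' ℤ_[p] x v xs hx, ← sub_eq_zero, ← Finset.sum_sub_distrib]
      rw [← sub_eq_zero (b := ∑ i ∈ Finset.range (r + k), a' i * entry l i),
        ← Finset.sum_sub_distrib]
      simp only [Int.cast_sub, sub_mul] at key
      rw [key]
      norm_cast
    rw [eqInt_eq]
    exact congrArg Part.some (if_congr hiff.symm rfl rfl)
  | rel R _ => exact isEmptyElim R
  | @imp k φ ψ ih ih' =>
    intro l x v xs hr hl hx hsim
    rw [freeBound, max_le_iff] at hr
    have h1 : formulaCode φ ≤ formulaCode (φ.imp ψ) :=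
      (Nat.left_le_pair _ _).trans (Nat.right_le_pair _ _)
    have h2 : formulaCode ψ ≤ formulaCode (φ.imp ψ) :=
      (Nat.right_le_pair _ _).trans (Nat.right_le_pair _ _)
    rw [formulaCode, Fimp, ih l x v xs hr.1 hl hx (hsim.mono (coeffBound_le h1)),
      ih' l x v xs hr.2 hl hx (hsim.mono (coeffBound_le h2)), Part.bind_some, Part.map_some]
    simp only [BoundedFormula.realize_imp]
    by_cases hφ : φ.Realize v xs <;> by_cases hψ : ψ.Realize v xs <;> simp [hφ, hψ]
  | @all k φ ih =>
    intro l x v xs hr hl hx hsim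
    rw [freeBound] at hr
    set c := formulaCode φ with hc
    have hlt : c < formulaCode φ.all := by
      have := Nat.add_le_pair 3 (formulaCode φ)
      rw [formulaCode]
      omega
    have hsim' := hsim.mono (two_mul_coeffBound_sq_le hlt)
    obtain ⟨w, hw⟩ := isUnit_natCast_of_coprime (coprime_unitProd (p := p) (coeffBound c))
    have hlen : ∀ i, (extendList p l c i).length = r + (k + 1) := fun i => by
      simp [extendList, hl]; omega
    have hentry : ∀ e, ∀ i < r + k + 1, entry (extendList p l c e) i =
        Function.update (fun i => (unitProd p (coeffBound c) : ℤ) * entry l i) (r + k)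
          (intOf e) i := fun e i hi => by
      rw [← hl]
      exact entry_extend (by omega)
    have hcast : ∀ y : ℤ, (fun i => ((Function.update
        (fun i => (unitProd p (coeffBound c) : ℤ) * entry l i) (r + k) y i : ℤ) : ℤ_[p])) =
        Function.update (fun i => w * (entry l i : ℤ_[p])) (r + k) (y : ℤ_[p]) := by
      intro y
      funext i
      by_cases hi : i = r + k
      · subst hi; simp
      · simp [Function.update_of_ne hi, hw]
    have hstep : ∀ e y, Sim (coeffBound c) (r + k + 1) (Function.update x (r + k) y)
        (fun i => (Function.update (fun i => (unitProd p (coeffBound c) : ℤ) * entry l i) (r + k)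
          (intOf e) i : ℤ)) →
        F (r, extendList p l c e) c = Part.some (if φ.Realize v (Fin.snoc xs y) then 1 else 0) :=
      fun e y h => ih (extendList p l c e) (Function.update x (r + k) y) v (Fin.snoc xs y) hr
        (hlen e) (hx.snoc y) (h.entry_congr (hentry e))
    -- The "back" direction: every integer that the bounded quantifier tries is matched by some
    -- `p`-adic `y`, so the computation on it halts with a meaningful truth value.
    have hback : ∀ e, ∃ y, Sim (coeffBound c) (r + k + 1) (Function.update x (r + k) y)
        (fun i => (Function.update (fun i => (unitProd p (coeffBound c) : ℤ) * entry l i) (r + k)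
          (intOf e) i : ℤ)) := by
      intro e
      obtain ⟨y, hy⟩ := (hsim'.unit_mul w).symm.exists_extend (intOf e)
      refine ⟨y, ?_⟩
      rw [hcast]
      exact hy.symm
    choose y hy using hback
    rw [formulaCode, Fall, rec_mul_indicator fun e _ => hstep e (y e) (hy e)]
    congr 1
    refine if_congr ?_ rfl rfl
    rw [BoundedFormula.realize_all]
    refine ⟨fun h y₀ => ?_, fun h i _ => h _⟩
    have hS := sum_abs_entry_le l
    rw [hl] at hS
    -- The "forth" direction: `y₀` is matched by an integer within the range of the quantifier. As
    -- `y₀` and `y e` are similar to the same integral tuple, one value of `F` gives the truth of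
    -- `φ` at both.
    obtain ⟨y', hy', hsy⟩ := hsim'.exists_extend_int hS y₀
    obtain ⟨e, he, rfl⟩ := exists_intOf_eq hy'
    have h1 := hstep e y₀ hsy
    rw [hstep e (y e) (hy e), if_pos (h e he)] at h1
    by_contra h0
    rw [if_neg h0] at h1
    exact one_ne_zero (Part.some_inj.1 h1)

/-! ### Paths and `p`-adic integers -/

section Isomorphism

variable {p : ℕ} [hp : Fact p.Prime]

theorem eq_of_forall_pow_dvd_sub {x y : ℤ_[p]} (h : ∀ k, (p : ℤ_[p]) ^ (k + 1) ∣ x - y) :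
    x = y := by
  rw [← PadicInt.ext_of_toZModPow]
  intro n
  rw [← sub_eq_zero, ← map_sub, ← RingHom.mem_ker, PadicInt.ker_toZModPow,
    Ideal.mem_span_singleton]
  exact (pow_dvd_pow _ n.le_succ).trans (h n)

theorem dvd_natCast_sub_iff {a b n : ℕ} :
    (p : ℤ_[p]) ^ n ∣ (a : ℤ_[p]) - b ↔ b ≡ a [MOD p ^ n] := by
  rw [Nat.modEq_iff_dvd]
  have h := PadicInt.pow_p_dvd_int_iff (p := p) n ((a : ℤ) - b)
  push_cast at h ⊢
  exact h

theorem exists_padicInt_of_path (X : ZpPaths p) :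
    ∃ x : ℤ_[p], ∀ k, (p : ℤ_[p]) ^ (k + 1) ∣ x - (X.1 k : ℤ_[p]) := by
  have hX := mem_paths_ZpTree.1 X.2
  -- Entry `i` is a residue modulo `p ^ (i + 1)`. One power is given up to match the indexing of
  -- `PadicInt.ofIntSeq`, and is regained below by comparing entries `k + 1` and `k`.
  have hi : ∀ i, (p : ℤ) ^ i ∣ (fun i => (X.1 i : ℤ)) (i + 1) - (fun i => (X.1 i : ℤ)) i := by
    intro i
    have := (Nat.modEq_iff_dvd.1 (hX.2 i).symm)
    push_cast at this
    exact (pow_dvd_pow _ i.le_succ).trans this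
  refine ⟨PadicInt.ofIntSeq _
    (PadicInt.isCauSeq_padicNorm_of_pow_dvd_sub (fun i => (X.1 i : ℤ)) p hi), fun k => ?_⟩
  have h := PadicInt.toZModPow_ofIntSeq_of_pow_dvd_sub (fun i => (X.1 i : ℤ)) p hi (k + 1)
  set x := PadicInt.ofIntSeq _
    (PadicInt.isCauSeq_padicNorm_of_pow_dvd_sub (fun i => (X.1 i : ℤ)) p hi)
  have h1 : (p : ℤ_[p]) ^ (k + 1) ∣ x - (X.1 (k + 1) : ℤ_[p]) := by
    rw [← Ideal.mem_span_singleton, ← PadicInt.ker_toZModPow, RingHom.mem_ker, map_sub, h]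
    simp
  have h2 := dvd_natCast_sub_iff.2 (hX.2 k).symm
  have h3 := dvd_add h1 h2
  rwa [sub_add_sub_cancel] at h3

/-- The `p`-adic integer with the residues given by a path. -/
noncomputable def toPadicInt (X : ZpPaths p) : ℤ_[p] := (exists_padicInt_of_path X).choose

theorem dvd_toPadicInt_sub (X : ZpPaths p) (k : ℕ) :
    (p : ℤ_[p]) ^ (k + 1) ∣ toPadicInt X - (X.1 k : ℤ_[p]) :=
  (exists_padicInt_of_path X).choose_spec k

theorem toPadicInt_eq {X : ZpPaths p} {x : ℤ_[p]}
    (h : ∀ k, (p : ℤ_[p]) ^ (k + 1) ∣ x - (X.1 k : ℤ_[p])) : toPadicInt X = x :=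
  eq_of_forall_pow_dvd_sub fun k => by
    have := dvd_sub (dvd_toPadicInt_sub X k) (h k)
    rwa [sub_sub_sub_cancel_right] at this

theorem toPadicInt_zero : toPadicInt (0 : ZpPaths p) = 0 :=
  toPadicInt_eq fun k => by
    change _ ∣ (0 : ℤ_[p]) - ((0 : ℕ) : ℤ_[p])
    simp

theorem toPadicInt_add (X Y : ZpPaths p) :
    toPadicInt (X + Y) = toPadicInt X + toPadicInt Y :=
  toPadicInt_eq fun k => by
    have h : (p : ℤ_[p]) ^ (k + 1) ∣ ((X.1 k + Y.1 k : ℕ) : ℤ_[p]) - ((X + Y).1 k : ℤ_[p]) :=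
      dvd_natCast_sub_iff.2 (Nat.mod_modEq _ _)
    have := dvd_add (dvd_add (dvd_toPadicInt_sub X k) (dvd_toPadicInt_sub Y k)) h
    convert this using 1
    push_cast
    ring

theorem toPadicInt_neg (X : ZpPaths p) : toPadicInt (-X) = -toPadicInt X :=
  toPadicInt_eq fun k => by
    have h : (p : ℤ_[p]) ^ (k + 1) ∣ ((p ^ (k + 1) - X.1 k : ℕ) : ℤ_[p]) - ((-X).1 k : ℤ_[p]) :=
      dvd_natCast_sub_iff.2 (Nat.mod_modEq _ _)
    rw [Nat.cast_sub ((mem_paths_ZpTree.1 X.2).1 k).le] at h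
    have := dvd_sub (dvd_sub h (dvd_toPadicInt_sub X k)) (dvd_refl ((p : ℤ_[p]) ^ (k + 1)))
    convert this using 1
    push_cast
    ring

theorem toPadicInt_injective : Function.Injective (toPadicInt : ZpPaths p → ℤ_[p]) := by
  intro X Y h
  refine Subtype.ext (funext fun k => ?_)
  have h1 := dvd_sub (dvd_toPadicInt_sub X k) (dvd_toPadicInt_sub Y k)
  rw [h, sub_sub_sub_cancel_left, dvd_natCast_sub_iff] at h1
  exact Nat.ModEq.eq_of_lt_of_lt h1 ((mem_paths_ZpTree.1 X.2).1 k) ((mem_paths_ZpTree.1 Y.2).1 k)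

theorem toPadicInt_surjective : Function.Surjective (toPadicInt : ZpPaths p → ℤ_[p]) := by
  intro x
  have hx : ∀ k, (p : ℤ_[p]) ^ k ∣ x - (x.appr k : ℤ_[p]) := fun k =>
    Ideal.mem_span_singleton.1 (PadicInt.appr_spec k x)
  refine ⟨⟨fun i => x.appr (i + 1), mem_paths_ZpTree.2
    ⟨fun i => PadicInt.appr_lt _ _, fun i => ?_⟩⟩, toPadicInt_eq fun k => hx (k + 1)⟩
  rw [← dvd_natCast_sub_iff (p := p)]
  have := dvd_sub ((pow_dvd_pow _ (i + 1).le_succ).trans (hx (i + 1 + 1))) (hx (i + 1))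
  rwa [sub_sub_sub_cancel_left] at this

/-- The tree `T_p^+` presents the additive group of the `p`-adic integers. -/
noncomputable def padicEquiv (p : ℕ) [Fact p.Prime] : addGroupLang.Equiv (ZpPaths p) ℤ_[p] where
  toEquiv := Equiv.ofBijective toPadicInt ⟨toPadicInt_injective, toPadicInt_surjective⟩
  map_fun' := by
    intro n f X
    change AddGroupFunc n at f
    cases f with
    | zero => exact toPadicInt_zero
    | neg => exact toPadicInt_neg (X 0)
    | add => exact toPadicInt_add (X 0) (X 1)
  map_rel' := fun r => isEmptyElim r

end Isomorphism

/-! ### The computable presentation -/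

section Presentation

variable (p : ℕ) [hp : Fact p.Prime]

theorem primrecPred_mem_ZpTree (p : ℕ) : PrimrecPred fun σ : List ℕ => σ ∈ ZpTree p := by
  have hget : Primrec fun q : List ℕ × ℕ => q.1.getD q.2 0 :=
    (Primrec.list_getD 0).comp Primrec.fst Primrec.snd
  have hget' : Primrec fun q : List ℕ × ℕ => q.1.getD (q.2 + 1) 0 :=
    (Primrec.list_getD 0).comp Primrec.fst (Primrec.succ.comp Primrec.snd)
  have hpow : Primrec fun q : List ℕ × ℕ => p ^ (q.2 + 1) :=
    primrec_pow (Primrec.const p) (Primrec.succ.comp Primrec.snd)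
  have h1 : PrimrecPred fun σ : List ℕ => ∀ i < σ.length, σ.getD i 0 < p ^ (i + 1) :=
    primrecPred_forall_lt Primrec.list_length (primrecPred_lt hget hpow)
  have h2 : PrimrecPred fun σ : List ℕ =>
      ∀ i < σ.length - 1, σ.getD (i + 1) 0 ≡ σ.getD i 0 [MOD p ^ (i + 1)] :=
    primrecPred_forall_lt (Primrec.nat_sub.comp Primrec.list_length (Primrec.const 1))
      (primrecPred_modEq hget' hget hpow)
  refine (h1.and h2).of_eq fun σ => and_congr ?_ ?_
  · refine forall₂_congr fun i hi => ?_
    rw [List.getD_eq_getElem _ _ hi]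
  · constructor
    · intro h i hi
      have := h i (by omega)
      rwa [List.getD_eq_getElem _ _ hi, List.getD_eq_getElem _ _ (by omega)] at this
    · intro h i hi
      have := h i (by omega)
      rwa [List.getD_eq_getElem _ _ (by omega), List.getD_eq_getElem _ _ (by omega)]

/-- Repeating the last entry forever gives a path, since the bounds only grow; the empty node lies
on the path `0`. -/
theorem exists_path_of_mem_ZpTree {σ : List ℕ} (hσ : σ ∈ ZpTree p) :
    ∃ X ∈ paths (ZpTree p), (List.range σ.length).map X = σ := by
  rcases σ.eq_nil_or_concat with rfl | ⟨τ, a, rfl⟩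
  · exact ⟨_, (0 : ZpPaths p).2, rfl⟩
  · obtain ⟨h1, h2⟩ := hσ
    simp only [List.concat_eq_append] at h1 h2 ⊢
    have hlen : (τ ++ [a]).length = τ.length + 1 := by simp
    have ha : a < p ^ (τ.length + 1) := by
      simpa using h1 τ.length (by simp)
    refine ⟨fun i => (τ ++ [a]).getD i a, mem_paths_ZpTree.2 ⟨fun i => ?_, fun i => ?_⟩, ?_⟩
    · rcases lt_or_ge i (τ ++ [a]).length with hi | hi
      · rw [List.getD_eq_getElem _ _ hi]
        exact h1 i hi
      · rw [List.getD_eq_default _ _ hi]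
        exact ha.trans_le (Nat.pow_le_pow_right hp.out.pos (by omega))
    · rcases lt_or_ge (i + 1) (τ ++ [a]).length with hi | hi
      · rw [List.getD_eq_getElem _ _ hi, List.getD_eq_getElem _ _ (by omega)]
        exact h2 i hi
      · rw [List.getD_eq_default _ _ hi]
        rcases lt_or_ge i (τ ++ [a]).length with hi' | hi'
        · have : i = τ.length := by omega
          subst this
          simp [Nat.ModEq.refl]
        · rw [List.getD_eq_default _ _ hi']
    · refine List.ext_getElem (by simp) fun i hi hi' => ?_
      rw [List.getElem_map, List.getElem_range, List.getD_eq_getElem _ _ hi']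

/-- The operations, given the symbol, the coordinate and the relevant values of the arguments. -/
def coordOp (p n k a b : ℕ) : ℕ :=
  if n = 0 then 0 else if n = 1 then (p ^ (k + 1) - a) % p ^ (k + 1) else (a + b) % p ^ (k + 1)

theorem exists_functional : ∃ Φ : OracleCode,
    ∀ (n : ℕ) (f : addGroupLang.Functions n) (X : Fin n → paths (ZpTree p)) (k : ℕ),
    Φ.eval (tupleJoin fun i => (X i : ℕ → ℕ)) (Nat.pair (Nat.pair n (SymbolCoding.code f)) k) =
      Part.some ((FirstOrder.Language.Structure.funMap f X : paths (ZpTree p)).val k) := by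
  have hid : Primrec fun m : ℕ => m := Primrec.id
  have hm : Primrec fun m : ℕ => m.unpair.1 := primrec_fst hid
  have hn : Primrec fun m : ℕ => m.unpair.1.unpair.1.unpair.1 := primrec_fst (primrec_fst hm)
  have hk : Primrec fun m : ℕ => m.unpair.1.unpair.2 := primrec_snd hm
  have ha : Primrec fun m : ℕ => m.unpair.2.unpair.1 := primrec_fst (primrec_snd hid)
  have hb : Primrec fun m : ℕ => m.unpair.2.unpair.2 := primrec_snd (primrec_snd hid)
  have hpow : Primrec fun m : ℕ => p ^ (m.unpair.1.unpair.2 + 1) :=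
    primrec_pow (Primrec.const p) (Primrec.succ.comp hk)
  have hop : Primrec fun m : ℕ => coordOp p m.unpair.1.unpair.1.unpair.1 m.unpair.1.unpair.2
      m.unpair.2.unpair.1 m.unpair.2.unpair.2 :=
    Primrec.ite (primrecPred_eq hn (Primrec.const 0)) (Primrec.const 0)
      (Primrec.ite (primrecPred_eq hn (Primrec.const 1))
        (Primrec.nat_mod.comp (Primrec.nat_sub.comp hpow ha) hpow)
        (Primrec.nat_mod.comp (Primrec.nat_add.comp ha hb) hpow))
  have hq : ∀ j : ℕ, Primrec fun m : ℕ => Nat.pair j m.unpair.2 := fun j =>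
    Primrec₂.natPair.comp (Primrec.const j) (primrec_snd hid)
  obtain ⟨op, hop⟩ := OracleCode.exists_eval_primrec hop
  obtain ⟨q0, hq0⟩ := OracleCode.exists_eval_primrec (hq 0)
  obtain ⟨q1, hq1⟩ := OracleCode.exists_eval_primrec (hq 1)
  obtain ⟨i, hi⟩ := OracleCode.exists_eval_primrec hid
  -- Coordinate `k` of two arguments is always queried; absent arguments read as `0` and are ignored
  -- by `coordOp`.
  refine ⟨.comp op (.pair i (.pair (.comp .oracle q0) (.comp .oracle q1))), fun n f X k => ?_⟩
  have ho : ∀ g m, OracleCode.oracle.eval g m = Part.some (g m) := fun _ _ => rfl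
  rw [OracleCode.eval_comp_eq (OracleCode.eval_pair_eq (hi _ _) (OracleCode.eval_pair_eq
    ((OracleCode.eval_comp_eq (hq0 _ _)).trans (ho _ _))
    ((OracleCode.eval_comp_eq (hq1 _ _)).trans (ho _ _)))), hop]
  simp only [Nat.unpair_pair]
  change AddGroupFunc n at f
  cases f with
  | zero => rfl
  | neg =>
    have h0 : tupleJoin (fun i => (X i : ℕ → ℕ)) (Nat.pair 0 k) = (X 0 : ℕ → ℕ) k := by
      simp [tupleJoin]
    rw [h0]
    rfl
  | add =>
    have h0 : tupleJoin (fun i => (X i : ℕ → ℕ)) (Nat.pair 0 k) = (X 0 : ℕ → ℕ) k := by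
      simp [tupleJoin]
    have h1 : tupleJoin (fun i => (X i : ℕ → ℕ)) (Nat.pair 1 k) = (X 1 : ℕ → ℕ) k := by
      simp [tupleJoin]
    rw [h0, h1]
    rfl

theorem isComputableTreePresentation_ZpTree :
    IsComputableTreePresentation addGroupLang (ZpTree p) where
  root_mem := ⟨fun i h => absurd h (Nat.not_lt_zero i), fun i h => absurd h (Nat.not_lt_zero _)⟩
  prefix_closed := by
    rintro σ τ ⟨ρ, rfl⟩ ⟨h1, h2⟩
    refine ⟨fun i hi => ?_, fun i hi => ?_⟩
    · have := h1 i (by rw [List.length_append]; omega)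
      rwa [List.getElem_append_left hi] at this
    · have := h2 i (by rw [List.length_append]; omega)
      rwa [List.getElem_append_left hi, List.getElem_append_left] at this
  computable := (primrecPred_mem_ZpTree p).computablePred
  extendible := fun _ hσ => exists_path_of_mem_ZpTree p hσ
  functional := exists_functional p

end Presentation

/-! ### Linear equations as atomic formulas -/

/-- The `i`-th digit of `t` in base `b + 1`. -/
def digit (b t i : ℕ) : ℕ := t / (b + 1) ^ i % (b + 1)

theorem exists_digit_eq {b : ℕ} (r : ℕ) {a : ℕ → ℕ} (ha : ∀ i, a i ≤ b) :
    ∃ t < (b + 1) ^ r, ∀ i < r, digit b t i = a i := by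
  let f : Fin r → Fin (b + 1) := fun i => ⟨a i, Nat.lt_succ_of_le (ha i)⟩
  refine ⟨finFunctionFinEquiv f, (finFunctionFinEquiv f).2, fun i hi => ?_⟩
  exact congrArg Fin.val (congrFun (finFunctionFinEquiv.symm_apply_apply f) ⟨i, hi⟩)

section Terms

variable {α : Type}

/-- The term `t + ⋯ + t` with `d` summands. -/
def mulTerm (d : ℕ) (t : addGroupLang.Term α) : addGroupLang.Term α :=
  Nat.rec zeroTerm (fun _ s => addTerm s t) d

/-- The term `a₀ t₀ + ⋯ + aᵣ₋₁ tᵣ₋₁`. -/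
def linTerm (a : ℕ → ℕ) (t : ℕ → addGroupLang.Term α) (r : ℕ) : addGroupLang.Term α :=
  Nat.rec zeroTerm (fun i s => addTerm s (mulTerm (a i) (t i))) r

theorem realize_mulTerm {A : Type} [CommRing A] (v : α → A) (d : ℕ) (t : addGroupLang.Term α) :
    (mulTerm d t).realize v = d * t.realize v := by
  induction d with
  | zero => exact (realize_zeroTerm v).trans (by simp)
  | succ d ih =>
    refine (realize_addTerm v (mulTerm d t) t).trans ?_
    rw [ih]
    push_cast
    ring

theorem realize_linTerm {A : Type} [CommRing A] (v : α → A) (a : ℕ → ℕ)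
    (t : ℕ → addGroupLang.Term α) (r : ℕ) :
    (linTerm a t r).realize v = ∑ i ∈ Finset.range r, (a i : A) * (t i).realize v := by
  induction r with
  | zero => exact (realize_zeroTerm v).trans (by simp)
  | succ r ih =>
    refine (realize_addTerm v (linTerm a t r) (mulTerm (a r) (t r))).trans ?_
    rw [ih, realize_mulTerm, Finset.sum_range_succ]

/-- The Gödel number of `t + ⋯ + t` with `d` summands. -/
def mulCode (d c : ℕ) : ℕ := Nat.rec zeroCode (fun _ s => addCode s c) d

/-- The Gödel number of `a₀ x₀ + ⋯ + aᵣ₋₁ xᵣ₋₁`, where the `aᵢ` are the digits of `t`. -/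
def linCode (b t r : ℕ) : ℕ :=
  Nat.rec zeroCode (fun i s => addCode s (mulCode (digit b t i) (Nat.pair 0 (2 * i)))) r

theorem termCode_mulTerm (v : α → ℕ) (d : ℕ) (t : addGroupLang.Term α) :
    termCode v (mulTerm d t) = mulCode d (termCode v t) := by
  induction d with
  | zero => exact termCode_zeroTerm v
  | succ d ih =>
    refine (termCode_addTerm v (mulTerm d t) t).trans ?_
    rw [ih]
    rfl

theorem termCode_linTerm (v : α → ℕ) (b t : ℕ) {r : ℕ} {w : ℕ → addGroupLang.Term α}
    (hw : ∀ i < r, termCode v (w i) = Nat.pair 0 (2 * i)) :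
    termCode v (linTerm (digit b t) w r) = linCode b t r := by
  induction r with
  | zero => exact termCode_zeroTerm v
  | succ r ih =>
    refine (termCode_addTerm v (linTerm (digit b t) w r) (mulTerm (digit b t r) (w r))).trans ?_
    rw [ih fun i hi => hw i (by omega), termCode_mulTerm, hw r (by omega)]
    rfl

end Terms

/-- The Gödel number of the equation between the linear forms given by `t` and `t'`. -/
def eqCode (b t t' r : ℕ) : ℕ := Nat.pair 1 (Nat.pair (linCode b t r) (linCode b t' r))

section Diagram

variable {p : ℕ} [hp : Fact p.Prime] {n : ℕ}

/-- The tuple of `p`-adic integers given by a tuple of paths. -/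
noncomputable def padicTuple (X : Fin n → ZpPaths p) (i : ℕ) : ℤ_[p] :=
  if h : i < n then toPadicInt (X ⟨i, h⟩) else 0

/-- Terms have only nonnegative multiples, so an integral relation is written as an equation between
two such forms. Its number does not depend on `n`, as a variable `xᵢ` is coded by `i` alone. -/
theorem eqCode_mem_positiveAtomicDiagram {X : Fin n → ZpPaths p} {b t t' r : ℕ} (hr : r ≤ n) :
    eqCode b t t' r ∈ positiveAtomicDiagram addGroupLang X ↔
      ∑ i ∈ Finset.range r, (digit b t i : ℤ_[p]) * padicTuple X i =
        ∑ i ∈ Finset.range r, (digit b t' i : ℤ_[p]) * padicTuple X i := by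
  let w : ℕ → addGroupLang.Term (Fin n ⊕ Fin 0) := fun i =>
    if h : i < n then .var (Sum.inl ⟨i, h⟩) else zeroTerm
  have hw : ∀ i < r, termCode varCode (w i) = Nat.pair 0 (2 * i) := fun i hi => by
    simp [w, hi.trans_le hr, termCode, varCode]
  have hval : ∀ (s : ℕ) (xs : Fin 0 → ℤ_[p]),
      (linTerm (digit b s) w r).realize (Sum.elim (padicEquiv p ∘ X) xs) =
      ∑ i ∈ Finset.range r, (digit b s i : ℤ_[p]) * padicTuple X i := by
    intro s xs
    rw [realize_linTerm]
    refine Finset.sum_congr rfl fun i hi => ?_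
    have hi' : i < n := (Finset.mem_range.1 hi).trans_le hr
    simp only [w, padicTuple, dif_pos hi']
    rfl
  have hcode : formulaCode ((linTerm (digit b t) w r).bdEqual (linTerm (digit b t') w r)) =
      eqCode b t t' r := by
    rw [Term.bdEqual, formulaCode, termCode_linTerm _ _ _ hw, termCode_linTerm _ _ _ hw]
    rfl
  constructor
  · rintro ⟨α, hα, hX, hc⟩
    rw [← StrongHomClass.realize_formula (padicEquiv p)] at hX
    cases hα with
    | rel R ts => exact isEmptyElim R
    | equal t₁ t₂ =>
      rw [← hcode] at hc
      simp only [Term.bdEqual, formulaCode, Nat.pair_eq_pair, true_and] at hc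
      rwa [Formula.Realize, BoundedFormula.realize_bdEqual,
        termCode_injective varCode_injective hc.1, termCode_injective varCode_injective hc.2,
        hval, hval] at hX
  · intro h
    refine ⟨(linTerm (digit b t) w r).bdEqual (linTerm (digit b t') w r),
      BoundedFormula.IsAtomic.equal _ _, ?_, hcode⟩
    rwa [← StrongHomClass.realize_formula (padicEquiv p), Formula.Realize,
      BoundedFormula.realize_bdEqual, hval, hval]

end Diagram

/-! ### The search for an integral tuple -/

/-- The equation between the linear forms given by `t` and `t'`, at a tuple of coded integers. -/
def IntEq (b t t' r : ℕ) (l : List ℕ) : Prop :=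
  -- Negative parts are moved to the opposite side, which keeps the test within `ℕ`.
  ∑ i ∈ Finset.range r, (digit b t i * (l.getD i 0).unpair.1 +
    digit b t' i * (l.getD i 0).unpair.2) =
  ∑ i ∈ Finset.range r, (digit b t' i * (l.getD i 0).unpair.1 +
    digit b t i * (l.getD i 0).unpair.2)

theorem intEq_iff {b t t' r : ℕ} {l : List ℕ} : IntEq b t t' r l ↔
    ∑ i ∈ Finset.range r, ((digit b t i : ℤ) - digit b t' i) * entry l i = 0 := by
  rw [IntEq, ← Nat.cast_inj (R := ℤ), ← sub_eq_zero]
  push_cast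
  rw [← Finset.sum_sub_distrib]
  refine Eq.congr (Finset.sum_congr rfl fun i _ => ?_) rfl
  rw [entry, intOf]
  ring

/-- The finite part `s` of the oracle lists the equation given by `t` and `t'`. -/
def Listed (b t t' r : ℕ) (s : List ℕ) : Prop :=
  ∃ y < s.length, s.getD (2 * Nat.pair (eqCode b t t' r) y + 1) 0 = 1

/-- The finite part `s` of the oracle refutes the equation given by `t` and `t'`. -/
def Refuted (p b t t' r : ℕ) (s : List ℕ) : Prop :=
  ∃ k < s.length, 2 * Nat.pair r k < s.length ∧
    ¬ ∑ i ∈ Finset.range r, digit b t i * s.getD (2 * Nat.pair i k) 0 ≡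
      ∑ i ∈ Finset.range r, digit b t' i * s.getD (2 * Nat.pair i k) 0 [MOD p ^ (k + 1)]

/-- The finite part `s` of the oracle shows that the tuple of integers `l` resembles the tuple
of paths. -/
def Fits (p r b : ℕ) (l s : List ℕ) : Prop :=
  l.length = r ∧ 2 * Nat.pair r b < s.length ∧
  (∀ i < r, (l.getD i 0).unpair.1 ≡
    (l.getD i 0).unpair.2 + s.getD (2 * Nat.pair i b) 0 [MOD p ^ b]) ∧
  ∀ t < (b + 1) ^ r, ∀ t' < (b + 1) ^ r,
    (IntEq b t t' r l ∧ Listed b t t' r s) ∨ (¬ IntEq b t t' r l ∧ Refuted p b t t' r s)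

/-! ### Primitive recursiveness of the acceptance test -/

section Primrec

variable {A : Type} [Primcodable A]

theorem primrec_digit {b t i : A → ℕ} (hb : Primrec b) (ht : Primrec t) (hi : Primrec i) :
    Primrec fun a => digit (b a) (t a) (i a) :=
  Primrec.nat_mod.comp (Primrec.nat_div.comp ht (primrec_pow (Primrec.succ.comp hb) hi))
    (Primrec.succ.comp hb)

theorem primrec_getD {s : A → List ℕ} {i : A → ℕ} (hs : Primrec s) (hi : Primrec i) :
    Primrec fun a => (s a).getD (i a) 0 :=
  (Primrec.list_getD 0).comp hs hi

theorem primrec_mulCode {d c : A → ℕ} (hd : Primrec d) (hc : Primrec c) :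
    Primrec fun a => mulCode (d a) (c a) :=
  Primrec.nat_rec' hd (Primrec.const zeroCode)
    (primrec_addCode.comp (Primrec.snd.comp Primrec.snd) (hc.comp Primrec.fst)).to₂

theorem primrec_linCode {b t r : A → ℕ} (hb : Primrec b) (ht : Primrec t) (hr : Primrec r) :
    Primrec fun a => linCode (b a) (t a) (r a) := by
  have h1 : Primrec fun q : A × ℕ × ℕ => digit (b q.1) (t q.1) q.2.1 :=
    primrec_digit (hb.comp Primrec.fst) (ht.comp Primrec.fst) (Primrec.fst.comp Primrec.snd)
  have h2 : Primrec fun q : A × ℕ × ℕ => Nat.pair 0 (2 * q.2.1) :=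
    Primrec₂.natPair.comp (Primrec.const 0)
      (Primrec.nat_mul.comp (Primrec.const 2) (Primrec.fst.comp Primrec.snd))
  have h3 : Primrec fun q : A × ℕ × ℕ =>
      addCode q.2.2 (mulCode (digit (b q.1) (t q.1) q.2.1) (Nat.pair 0 (2 * q.2.1))) :=
    primrec_addCode.comp (Primrec.snd.comp Primrec.snd) (primrec_mulCode h1 h2)
  exact Primrec.nat_rec' hr (Primrec.const zeroCode) h3.to₂

theorem primrec_eqCode {b t t' r : A → ℕ} (hb : Primrec b) (ht : Primrec t) (ht' : Primrec t')
    (hr : Primrec r) : Primrec fun a => eqCode (b a) (t a) (t' a) (r a) :=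
  Primrec₂.natPair.comp (Primrec.const 1)
    (Primrec₂.natPair.comp (primrec_linCode hb ht hr) (primrec_linCode hb ht' hr))

theorem primrecPred_intEq {b t t' r : A → ℕ} {l : A → List ℕ} (hb : Primrec b) (ht : Primrec t)
    (ht' : Primrec t') (hr : Primrec r) (hl : Primrec l) :
    PrimrecPred fun a => IntEq (b a) (t a) (t' a) (r a) (l a) := by
  have hd : ∀ {t : A → ℕ}, Primrec t → Primrec fun q : A × ℕ => digit (b q.1) (t q.1) q.2 :=
    fun ht => primrec_digit (hb.comp Primrec.fst) (ht.comp Primrec.fst) Primrec.snd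
  have hg : Primrec fun q : A × ℕ => (l q.1).getD q.2 0 :=
    primrec_getD (hl.comp Primrec.fst) Primrec.snd
  have hs : ∀ {t t' : A → ℕ}, Primrec t → Primrec t' → Primrec fun a =>
      ∑ i ∈ Finset.range (r a), (digit (b a) (t a) i * ((l a).getD i 0).unpair.1 +
        digit (b a) (t' a) i * ((l a).getD i 0).unpair.2) := fun ht ht' =>
    primrec_sum_range hr (Primrec.nat_add.comp (Primrec.nat_mul.comp (hd ht) (primrec_fst hg))
      (Primrec.nat_mul.comp (hd ht') (primrec_snd hg))).to₂
  exact primrecPred_eq (hs ht ht') (hs ht' ht)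

theorem primrecPred_listed {b t t' r : A → ℕ} {s : A → List ℕ} (hb : Primrec b) (ht : Primrec t)
    (ht' : Primrec t') (hr : Primrec r) (hs : Primrec s) :
    PrimrecPred fun a => Listed (b a) (t a) (t' a) (r a) (s a) := by
  have h1 : Primrec fun q : A × ℕ =>
      2 * Nat.pair (eqCode (b q.1) (t q.1) (t' q.1) (r q.1)) q.2 + 1 :=
    Primrec.nat_double_succ.comp (Primrec₂.natPair.comp
      ((primrec_eqCode hb ht ht' hr).comp Primrec.fst) Primrec.snd)
  exact primrecPred_exists_lt (Primrec.list_length.comp hs)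
    (primrecPred_eq (primrec_getD (hs.comp Primrec.fst) h1) (Primrec.const 1))

theorem primrecPred_refuted {p : ℕ} {b t t' r : A → ℕ} {s : A → List ℕ} (hb : Primrec b)
    (ht : Primrec t) (ht' : Primrec t') (hr : Primrec r) (hs : Primrec s) :
    PrimrecPred fun a => Refuted p (b a) (t a) (t' a) (r a) (s a) := by
  have h1 : Primrec fun q : (A × ℕ) × ℕ => (s q.1.1).getD (2 * Nat.pair q.2 q.1.2) 0 :=
    primrec_getD (hs.comp (Primrec.fst.comp Primrec.fst)) (Primrec.nat_double.comp
      (Primrec₂.natPair.comp Primrec.snd (Primrec.snd.comp Primrec.fst)))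
  have h2 : ∀ {t : A → ℕ}, Primrec t → Primrec fun q : A × ℕ =>
      ∑ i ∈ Finset.range (r q.1), digit (b q.1) (t q.1) i * (s q.1).getD (2 * Nat.pair i q.2) 0 :=
    fun ht => primrec_sum_range (hr.comp Primrec.fst) (Primrec.nat_mul.comp
      (primrec_digit (hb.comp (Primrec.fst.comp Primrec.fst))
        (ht.comp (Primrec.fst.comp Primrec.fst)) Primrec.snd) h1).to₂
  have h3 : Primrec fun q : A × ℕ => 2 * Nat.pair (r q.1) q.2 :=
    Primrec.nat_double.comp (Primrec₂.natPair.comp (hr.comp Primrec.fst) Primrec.snd)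
  have h4 : Primrec fun q : A × ℕ => p ^ (q.2 + 1) :=
    primrec_pow (Primrec.const p) (Primrec.succ.comp Primrec.snd)
  exact primrecPred_exists_lt (Primrec.list_length.comp hs)
    ((primrecPred_lt h3 (Primrec.list_length.comp (hs.comp Primrec.fst))).and
      (primrecPred_modEq (h2 ht) (h2 ht') h4).not)

theorem primrecPred_residues {p : ℕ} {r b : A → ℕ} {l s : A → List ℕ} (hr : Primrec r)
    (hb : Primrec b) (hl : Primrec l) (hs : Primrec s) :
    PrimrecPred fun a => ∀ i < r a, ((l a).getD i 0).unpair.1 ≡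
      ((l a).getD i 0).unpair.2 + (s a).getD (2 * Nat.pair i (b a)) 0 [MOD p ^ b a] := by
  have hg : Primrec fun q : A × ℕ => (l q.1).getD q.2 0 :=
    primrec_getD (hl.comp Primrec.fst) Primrec.snd
  have h1 : Primrec fun q : A × ℕ => (s q.1).getD (2 * Nat.pair q.2 (b q.1)) 0 :=
    primrec_getD (hs.comp Primrec.fst) (Primrec.nat_double.comp
      (Primrec₂.natPair.comp Primrec.snd (hb.comp Primrec.fst)))
  have h2 : Primrec fun q : A × ℕ => ((l q.1).getD q.2 0).unpair.2 +
      (s q.1).getD (2 * Nat.pair q.2 (b q.1)) 0 :=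
    Primrec.nat_add.comp (primrec_snd hg) h1
  have h3 : Primrec fun q : A × ℕ => p ^ b q.1 :=
    primrec_pow (Primrec.const p) (hb.comp Primrec.fst)
  exact primrecPred_forall_lt hr (primrecPred_modEq (primrec_fst hg) h2 h3)

theorem primrecPred_relations {p : ℕ} {r b : A → ℕ} {l s : A → List ℕ} (hr : Primrec r)
    (hb : Primrec b) (hl : Primrec l) (hs : Primrec s) :
    PrimrecPred fun a => ∀ t < (b a + 1) ^ r a, ∀ t' < (b a + 1) ^ r a,
      (IntEq (b a) t t' (r a) (l a) ∧ Listed (b a) t t' (r a) (s a)) ∨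
        (¬ IntEq (b a) t t' (r a) (l a) ∧ Refuted p (b a) t t' (r a) (s a)) := by
  have hpow : Primrec fun a => (b a + 1) ^ r a := primrec_pow (Primrec.succ.comp hb) hr
  have pr : Primrec fun q : (A × ℕ) × ℕ => q.1.1 := Primrec.fst.comp Primrec.fst
  have ht : Primrec fun q : (A × ℕ) × ℕ => q.1.2 := Primrec.snd.comp Primrec.fst
  have hr' : Primrec fun q : (A × ℕ) × ℕ => r q.1.1 := hr.comp pr
  have hb' : Primrec fun q : (A × ℕ) × ℕ => b q.1.1 := hb.comp pr
  have hl' : Primrec fun q : (A × ℕ) × ℕ => l q.1.1 := hl.comp pr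
  have hs' : Primrec fun q : (A × ℕ) × ℕ => s q.1.1 := hs.comp pr
  have hI : PrimrecPred fun q : (A × ℕ) × ℕ => IntEq (b q.1.1) q.1.2 q.2 (r q.1.1) (l q.1.1) :=
    primrecPred_intEq hb' ht Primrec.snd hr' hl'
  have hL : PrimrecPred fun q : (A × ℕ) × ℕ => Listed (b q.1.1) q.1.2 q.2 (r q.1.1) (s q.1.1) :=
    primrecPred_listed hb' ht Primrec.snd hr' hs'
  have hR : PrimrecPred fun q : (A × ℕ) × ℕ =>
      Refuted p (b q.1.1) q.1.2 q.2 (r q.1.1) (s q.1.1) :=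
    primrecPred_refuted hb' ht Primrec.snd hr' hs'
  have h3 : PrimrecPred fun q : A × ℕ => ∀ t' < (b q.1 + 1) ^ r q.1,
      (IntEq (b q.1) q.2 t' (r q.1) (l q.1) ∧ Listed (b q.1) q.2 t' (r q.1) (s q.1)) ∨
        (¬ IntEq (b q.1) q.2 t' (r q.1) (l q.1) ∧ Refuted p (b q.1) q.2 t' (r q.1) (s q.1)) :=
    primrecPred_forall_lt (f := fun q : A × ℕ => (b q.1 + 1) ^ r q.1) (R := fun q t' =>
      (IntEq (b q.1) q.2 t' (r q.1) (l q.1) ∧ Listed (b q.1) q.2 t' (r q.1) (s q.1)) ∨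
        (¬ IntEq (b q.1) q.2 t' (r q.1) (l q.1) ∧ Refuted p (b q.1) q.2 t' (r q.1) (s q.1)))
      (hpow.comp Primrec.fst) ((hI.and hL).or (hI.not.and hR))
  exact primrecPred_forall_lt (f := fun a => (b a + 1) ^ r a) (R := fun a t =>
    ∀ t' < (b a + 1) ^ r a,
      (IntEq (b a) t t' (r a) (l a) ∧ Listed (b a) t t' (r a) (s a)) ∨
        (¬ IntEq (b a) t t' (r a) (l a) ∧ Refuted p (b a) t t' (r a) (s a))) hpow h3

theorem primrecPred_fits {p : ℕ} {r b : A → ℕ} {l s : A → List ℕ} (hr : Primrec r)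
    (hb : Primrec b) (hl : Primrec l) (hs : Primrec s) :
    PrimrecPred fun a => Fits p (r a) (b a) (l a) (s a) := by
  have h1 : PrimrecPred fun a => 2 * Nat.pair (r a) (b a) < (s a).length :=
    primrecPred_lt (Primrec.nat_double.comp (Primrec₂.natPair.comp hr hb))
      (Primrec.list_length.comp hs)
  exact (primrecPred_eq (Primrec.list_length.comp hl) hr).and
    (h1.and ((primrecPred_residues hr hb hl hs).and (primrecPred_relations hr hb hl hs)))

end Primrec

/-! ### Reading the oracle from its initial segments -/

theorem length_segment (g : ℕ → ℕ) (w : ℕ) : (segment g w).length = w := by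
  simp [segment]

theorem getD_segment (g : ℕ → ℕ) {w i : ℕ} (h : i < w) : (segment g w).getD i 0 = g i := by
  rw [List.getD_eq_getElem _ _ (by rwa [length_segment])]
  simp [segment]

theorem join_two_mul (X Y : ℕ → ℕ) (m : ℕ) : join X Y (2 * m) = X m := by
  simp [join]

theorem join_two_mul_add_one (X Y : ℕ → ℕ) (m : ℕ) : join X Y (2 * m + 1) = Y m := by
  have h1 : (2 * m + 1) / 2 = m := by omega
  have h2 : (2 * m + 1) % 2 ≠ 0 := by omega
  rw [join, if_neg h2, h1]

theorem charFun_eq_one_iff {D : Set ℕ} {m : ℕ} : charFun D m = 1 ↔ m ∈ D := by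
  by_cases h : m ∈ D <;> simp [charFun, h]

theorem digit_le (b t i : ℕ) : digit b t i ≤ b := Nat.le_of_lt_succ (Nat.mod_lt _ b.succ_pos)

/-- The oracle of a tuple of paths and of an enumeration. -/
noncomputable def tupleOracle {p n : ℕ} (X : Fin n → ZpPaths p) (D : Set ℕ) : ℕ → ℕ :=
  join (tupleJoin fun i => (X i : ℕ → ℕ)) (charFun D)

theorem getD_tupleOracle_path {p n : ℕ} {X : Fin n → ZpPaths p} {D : Set ℕ} {r i k w : ℕ}
    (hi : i < r) (hw : 2 * Nat.pair r k < w) :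
    (segment (tupleOracle X D) w).getD (2 * Nat.pair i k) 0 =
      tupleJoin (fun i => (X i : ℕ → ℕ)) (Nat.pair i k) := by
  have := Nat.pair_lt_pair_left k hi
  rw [getD_segment _ (by omega), tupleOracle, join_two_mul]

/-! ### Existence, soundness and recognition of integral tuples -/

section Search

variable {p : ℕ} [hp : Fact p.Prime]

theorem exists_list_sim (r b : ℕ) (x : ℕ → ℤ_[p]) :
    ∃ l : List ℕ, l.length = r ∧ Sim b r x fun i => (entry l i : ℤ_[p]) := by
  induction r generalizing b with
  | zero => exact ⟨[], rfl, fun a _ => by simp, 1, fun i hi => absurd hi (Nat.not_lt_zero i)⟩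
  | succ r ih =>
    -- The entries of `x` are added one at a time, so the level must be raised before each earlier
    -- step.
    obtain ⟨l, rfl, hl⟩ := ih (2 * b ^ 2)
    obtain ⟨y, -, hy⟩ := hl.exists_extend_int (sum_abs_entry_le l) (x l.length)
    obtain ⟨e, -, rfl⟩ := exists_intOf_eq (y := y) (h := y.natAbs) (by rw [Int.abs_eq_natAbs])
    refine ⟨l.map (scaleCode (unitProd p b)) ++ [e], by simp, ?_⟩
    rw [Function.update_eq_self] at hy
    exact hy.entry_congr fun i hi => entry_extend (Nat.le_of_lt_succ hi)

/-- The unit is normalised to `1`, so the search can compare residues directly. Multiplying the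
tuple by a nonzero integer close to `u⁻¹` changes no linear relation. -/
theorem exists_list_congruent (r b : ℕ) (x : ℕ → ℤ_[p]) :
    ∃ l : List ℕ, l.length = r ∧ Sim b r x (fun i => (entry l i : ℤ_[p])) ∧
      ∀ i < r, (p : ℤ_[p]) ^ b ∣ (entry l i : ℤ_[p]) - x i := by
  obtain ⟨l, hl, hrel, u, hu⟩ := exists_list_sim r b x
  -- One digit beyond `b` guarantees a nonzero approximation even for `b = 0`: otherwise `p` would
  -- divide a unit.
  obtain ⟨k, hk⟩ : (p : ℤ_[p]) ^ (b + 1) ∣ (↑u⁻¹ : ℤ_[p]) - ((↑u⁻¹ : ℤ_[p]).appr (b + 1) : ℤ_[p]) :=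
    Ideal.mem_span_singleton.1 (PadicInt.appr_spec (b + 1) (↑u⁻¹ : ℤ_[p]))
  set c := (↑u⁻¹ : ℤ_[p]).appr (b + 1)
  have hu1 : (↑u⁻¹ : ℤ_[p]) * u = 1 := u.inv_mul
  have hc : (c : ℤ_[p]) ≠ 0 := by
    intro h0
    rw [h0, sub_zero] at hk
    have hpu : IsUnit (p : ℤ_[p]) := isUnit_of_dvd_unit (y := (↑u⁻¹ : ℤ_[p]))
      ⟨(p : ℤ_[p]) ^ b * k, by rw [hk]; ring⟩ (Units.isUnit _)
    exact PadicInt.prime_p.not_isUnit hpu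
  have hentry : ∀ i, entry (l.map (scaleCode c)) i = c * entry l i := by
    intro i
    rw [entry, entry, ← intOf_scaleCode]
    rcases lt_or_ge i l.length with hi | hi
    · simp [hi]
    · simp [hi, scaleCode, intOf]
  have hdvd : ∀ i < r, (p : ℤ_[p]) ^ b ∣ (entry (l.map (scaleCode c)) i : ℤ_[p]) - x i := by
    intro i hi
    obtain ⟨m, hm⟩ := hu i hi
    refine ⟨c * m - p * k * u * x i, ?_⟩
    rw [hentry]
    push_cast
    linear_combination (c : ℤ_[p]) * hm - (u : ℤ_[p]) * x i * hk + x i * hu1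
  refine ⟨l.map (scaleCode c), by simpa using hl, ⟨fun a ha => ?_, 1, fun i hi => ?_⟩, hdvd⟩
  · rw [hrel a ha]
    have : ∑ i ∈ Finset.range r, (a i : ℤ_[p]) * (entry (l.map (scaleCode c)) i : ℤ_[p]) =
        c * ∑ i ∈ Finset.range r, (a i : ℤ_[p]) * (entry l i : ℤ_[p]) := by
      rw [Finset.mul_sum]
      refine Finset.sum_congr rfl fun i _ => ?_
      rw [hentry]
      push_cast
      ring
    rw [this, mul_eq_zero, or_iff_right hc]
  · simpa using hdvd i hi

variable {n : ℕ} {X : Fin n → ZpPaths p}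

theorem dvd_padicTuple_sub (X : Fin n → ZpPaths p) (i k : ℕ) : (p : ℤ_[p]) ^ (k + 1) ∣
    padicTuple X i - (tupleJoin (fun i => (X i : ℕ → ℕ)) (Nat.pair i k) : ℤ_[p]) := by
  by_cases h : i < n
  · simp only [padicTuple, tupleJoin, Nat.unpair_pair, dif_pos h]
    exact dvd_toPadicInt_sub _ k
  · simp [padicTuple, tupleJoin, h]

/-- Failure of a relation is therefore visible at a finite level of the paths; its truth is not,
which is why the enumeration is needed. -/
theorem sum_padicTuple_eq_iff {r : ℕ} {c c' : ℕ → ℕ} :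
    ∑ i ∈ Finset.range r, (c i : ℤ_[p]) * padicTuple X i =
      ∑ i ∈ Finset.range r, (c' i : ℤ_[p]) * padicTuple X i ↔
    ∀ k, ∑ i ∈ Finset.range r, c i * tupleJoin (fun i => (X i : ℕ → ℕ)) (Nat.pair i k) ≡
      ∑ i ∈ Finset.range r, c' i * tupleJoin (fun i => (X i : ℕ → ℕ)) (Nat.pair i k)
        [MOD p ^ (k + 1)] := by
  have key : ∀ (c : ℕ → ℕ) (k : ℕ), (p : ℤ_[p]) ^ (k + 1) ∣
      ∑ i ∈ Finset.range r, (c i : ℤ_[p]) * padicTuple X i -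
        ((∑ i ∈ Finset.range r, c i * tupleJoin (fun i => (X i : ℕ → ℕ)) (Nat.pair i k) : ℕ) :
          ℤ_[p]) := by
    intro c k
    push_cast
    rw [← Finset.sum_sub_distrib]
    refine Finset.dvd_sum fun i _ => ?_
    rw [← mul_sub]
    exact (dvd_padicTuple_sub X i k).mul_left _
  constructor
  · intro h k
    have := dvd_sub (key c' k) (key c k)
    rw [h, sub_sub_sub_cancel_left] at this
    exact (dvd_natCast_sub_iff.1 this).symm
  · intro h
    refine eq_of_forall_pow_dvd_sub fun k => ?_
    have h1 := dvd_add (dvd_sub (key c k) (key c' k)) (dvd_natCast_sub_iff.2 (h k).symm)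
    convert h1 using 1
    ring

theorem not_sum_eq_of_refuted {D : Set ℕ} {b t t' r w : ℕ}
    (h : Refuted p b t t' r (segment (tupleOracle X D) w)) :
    ∑ i ∈ Finset.range r, (digit b t i : ℤ_[p]) * padicTuple X i ≠
      ∑ i ∈ Finset.range r, (digit b t' i : ℤ_[p]) * padicTuple X i := by
  obtain ⟨k, -, hk, hne⟩ := h
  rw [length_segment] at hk
  intro h0
  refine hne ?_
  have hs : ∀ c : ℕ → ℕ, ∑ i ∈ Finset.range r,
      c i * (segment (tupleOracle X D) w).getD (2 * Nat.pair i k) 0 =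
      ∑ i ∈ Finset.range r, c i * tupleJoin (fun i => (X i : ℕ → ℕ)) (Nat.pair i k) := fun c =>
    Finset.sum_congr rfl fun i hi => by
      rw [getD_tupleOracle_path (Finset.mem_range.1 hi) hk]
  rw [hs, hs]
  exact sum_padicTuple_eq_iff.1 h0 k

theorem eventually_refuted {D : Set ℕ} {b t t' r : ℕ}
    (h : ∑ i ∈ Finset.range r, (digit b t i : ℤ_[p]) * padicTuple X i ≠
      ∑ i ∈ Finset.range r, (digit b t' i : ℤ_[p]) * padicTuple X i) :
    ∀ᶠ w in Filter.atTop, Refuted p b t t' r (segment (tupleOracle X D) w) := by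
  rw [Ne, sum_padicTuple_eq_iff, not_forall] at h
  obtain ⟨k, hk⟩ := h
  filter_upwards [Filter.eventually_gt_atTop (2 * Nat.pair r k)] with w hw
  have := Nat.right_le_pair r k
  refine ⟨k, by rw [length_segment]; omega, by rwa [length_segment], ?_⟩
  have hs : ∀ c : ℕ → ℕ, ∑ i ∈ Finset.range r,
      c i * (segment (tupleOracle X D) w).getD (2 * Nat.pair i k) 0 =
      ∑ i ∈ Finset.range r, c i * tupleJoin (fun i => (X i : ℕ → ℕ)) (Nat.pair i k) := fun c =>
    Finset.sum_congr rfl fun i hi => by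
      rw [getD_tupleOracle_path (Finset.mem_range.1 hi) hw]
  rwa [hs, hs]

variable {D : Set ℕ} (hD : IsEnumeration D (positiveAtomicDiagram addGroupLang X))

include hD

theorem sum_eq_of_listed {b t t' r w : ℕ} (hr : r ≤ n)
    (h : Listed b t t' r (segment (tupleOracle X D) w)) :
    ∑ i ∈ Finset.range r, (digit b t i : ℤ_[p]) * padicTuple X i =
      ∑ i ∈ Finset.range r, (digit b t' i : ℤ_[p]) * padicTuple X i := by
  obtain ⟨y, -, hy⟩ := h
  rw [← eqCode_mem_positiveAtomicDiagram hr, hD]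
  refine ⟨y, ?_⟩
  rcases lt_or_ge (2 * Nat.pair (eqCode b t t' r) y + 1) w with hw | hw
  · rwa [getD_segment _ hw, tupleOracle, join_two_mul_add_one, charFun_eq_one_iff] at hy
  -- Positions beyond the segment read as `0` and never count as listed.
  · rw [List.getD_eq_default _ _ (by rwa [length_segment])] at hy
    exact absurd hy zero_ne_one

theorem eventually_listed {b t t' r : ℕ} (hr : r ≤ n)
    (h : ∑ i ∈ Finset.range r, (digit b t i : ℤ_[p]) * padicTuple X i =
      ∑ i ∈ Finset.range r, (digit b t' i : ℤ_[p]) * padicTuple X i) :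
    ∀ᶠ w in Filter.atTop, Listed b t t' r (segment (tupleOracle X D) w) := by
  rw [← eqCode_mem_positiveAtomicDiagram hr, hD] at h
  obtain ⟨y, hy⟩ := h
  filter_upwards [Filter.eventually_gt_atTop (2 * Nat.pair (eqCode b t t' r) y + 1)] with w hw
  have := Nat.right_le_pair (eqCode b t t' r) y
  refine ⟨y, by rw [length_segment]; omega, ?_⟩
  rwa [getD_segment _ hw, tupleOracle, join_two_mul_add_one, charFun_eq_one_iff]

/-- Soundness of the search: listed equations are true and refuted ones false, so the finite
evidence settles each bounded relation correctly, and the residues give agreement with unit `1`. -/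
theorem sim_of_fits {r b w : ℕ} {l : List ℕ} (hr : r ≤ n)
    (h : Fits p r b l (segment (tupleOracle X D) w)) :
    Sim b r (padicTuple X) fun i => (entry l i : ℤ_[p]) := by
  obtain ⟨-, hb, hres, hrel⟩ := h
  rw [length_segment] at hb
  refine ⟨fun a ha => ?_, 1, fun i hi => ?_⟩
  -- The positive and negative parts of the coefficients become the digits of `t` and `t'`.
  · obtain ⟨t, ht, hta⟩ := exists_digit_eq (b := b) r (a := fun i => (a i).toNat) fun i => by
      have := abs_le.1 (ha i)
      omega
    obtain ⟨t', ht', hta'⟩ := exists_digit_eq (b := b) r (a := fun i => (-a i).toNat) fun i => by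
      have := abs_le.1 (ha i)
      omega
    have hdig : ∀ i < r, (digit b t i : ℤ) - digit b t' i = a i := fun i hi => by
      rw [hta i hi, hta' i hi]
      omega
    have e1 : IntEq b t t' r l ↔
        ∑ i ∈ Finset.range r, (a i : ℤ_[p]) * (entry l i : ℤ_[p]) = 0 := by
      have hs : ∑ i ∈ Finset.range r, ((digit b t i : ℤ) - digit b t' i) * entry l i =
          ∑ i ∈ Finset.range r, a i * entry l i :=
        Finset.sum_congr rfl fun i hi => by rw [hdig i (Finset.mem_range.1 hi)]
      rw [intEq_iff, hs]
      norm_cast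
    have e2 : ∑ i ∈ Finset.range r, (digit b t i : ℤ_[p]) * padicTuple X i =
        ∑ i ∈ Finset.range r, (digit b t' i : ℤ_[p]) * padicTuple X i ↔
        ∑ i ∈ Finset.range r, (a i : ℤ_[p]) * padicTuple X i = 0 := by
      rw [← sub_eq_zero, ← Finset.sum_sub_distrib]
      refine Eq.congr (Finset.sum_congr rfl fun i hi => ?_) rfl
      rw [← hdig i (Finset.mem_range.1 hi)]
      push_cast
      ring
    rw [← e1, ← e2]
    rcases hrel t ht t' ht' with h | h
    · exact iff_of_true (sum_eq_of_listed hD hr h.2) h.1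
    · exact iff_of_false (not_sum_eq_of_refuted h.2) h.1
  · have h1 := hres i hi
    rw [getD_tupleOracle_path hi hb, ← dvd_natCast_sub_iff (p := p)] at h1
    have h2 := (pow_dvd_pow (p : ℤ_[p]) b.le_succ).trans (dvd_padicTuple_sub X i b)
    have h3 := dvd_add h1 h2
    rw [← dvd_neg]
    convert h3 using 1
    simp only [entry, intOf]
    push_cast
    ring

/-- Termination of the search: each of the finitely many relations is eventually listed or refuted,
as appropriate. One tuple fits all long segments, whatever number then codes the candidate. -/
theorem exists_eventually_fits {r : ℕ} (hr : r ≤ n) (b : ℕ) :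
    ∃ l : List ℕ, ∀ᶠ w in Filter.atTop, Fits p r b l (segment (tupleOracle X D) w) := by
  obtain ⟨l, hl, ⟨hrel, -⟩, hdvd⟩ := exists_list_congruent r b (padicTuple X)
  have hpair : ∀ t t', ∀ᶠ w in Filter.atTop,
      (IntEq b t t' r l ∧ Listed b t t' r (segment (tupleOracle X D) w)) ∨
        (¬ IntEq b t t' r l ∧ Refuted p b t t' r (segment (tupleOracle X D) w)) := by
    intro t t'
    have key := hrel (fun i => (digit b t i : ℤ) - digit b t' i) fun i => by
      have h1 := digit_le b t i
      have h2 := digit_le b t' i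
      rw [abs_le]
      constructor <;> omega
    have e1 : IntEq b t t' r l ↔ ∑ i ∈ Finset.range r,
        (((digit b t i : ℤ) - digit b t' i : ℤ) : ℤ_[p]) * (entry l i : ℤ_[p]) = 0 := by
      rw [intEq_iff]
      norm_cast
    have e2 : ∑ i ∈ Finset.range r, (digit b t i : ℤ_[p]) * padicTuple X i =
        ∑ i ∈ Finset.range r, (digit b t' i : ℤ_[p]) * padicTuple X i ↔
        ∑ i ∈ Finset.range r, (((digit b t i : ℤ) - digit b t' i : ℤ) : ℤ_[p]) *
          padicTuple X i = 0 := by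
      rw [← sub_eq_zero, ← Finset.sum_sub_distrib]
      refine Eq.congr (Finset.sum_congr rfl fun i _ => ?_) rfl
      push_cast
      ring
    rw [← e1, ← e2] at key
    by_cases h : IntEq b t t' r l
    · exact (eventually_listed hD hr (key.2 h)).mono fun w hw => Or.inl ⟨h, hw⟩
    · exact (eventually_refuted fun h0 => h (key.1 h0)).mono fun w hw => Or.inr ⟨h, hw⟩
  refine ⟨l, ?_⟩
  have hall : ∀ᶠ w in Filter.atTop, ∀ t ∈ Set.Iio ((b + 1) ^ r), ∀ t' ∈ Set.Iio ((b + 1) ^ r),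
      (IntEq b t t' r l ∧ Listed b t t' r (segment (tupleOracle X D) w)) ∨
        (¬ IntEq b t t' r l ∧ Refuted p b t t' r (segment (tupleOracle X D) w)) :=
    (Filter.eventually_all_finite (Set.finite_Iio _)).2 fun t _ =>
      (Filter.eventually_all_finite (Set.finite_Iio _)).2 fun t' _ => hpair t t'
  filter_upwards [hall, Filter.eventually_gt_atTop (2 * Nat.pair r b)] with w hw hw'
  refine ⟨hl, by rwa [length_segment], fun i hi => ?_, hw⟩
  rw [getD_tupleOracle_path hi hw', ← dvd_natCast_sub_iff (p := p)]
  have h2 := (pow_dvd_pow (p : ℤ_[p]) b.le_succ).trans (dvd_padicTuple_sub X i b)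
  have h3 := dvd_add (hdvd i hi) h2
  rw [← dvd_neg]
  convert h3 using 1
  simp only [entry, intOf]
  push_cast
  ring

end Search

/-- Any tuple accepted by the search is similar to the paths at the level the formula requires, so
evaluating the formula at it gives the right answer, whichever tuple is met first. -/
theorem isTreeDecidable_ZpTree (p : ℕ) [Fact p.Prime] :
    IsTreeDecidable addGroupLang (ZpTree p) := by
  classical
  obtain ⟨B, hB, hBφ⟩ := exists_partrec_freeBound
  obtain ⟨F, hF, hFφ⟩ := exists_partrec_realize p
  let tuple : ℕ → List ℕ := fun w => Denumerable.ofNat (List ℕ) w.unpair.1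
  have htuple : Primrec tuple := (Primrec.ofNat (List ℕ)).comp (primrec_fst Primrec.id)
  have hfits : Primrec fun q : (ℕ × ℕ × List ℕ) × ℕ =>
      if Fits p q.2 (coeffBound q.1.1) (tuple q.1.2.1) q.1.2.2 then 0 else 1 :=
    Primrec.ite (primrecPred_fits Primrec.snd
      (primrec_coeffBound.comp (Primrec.fst.comp Primrec.fst))
      (htuple.comp (Primrec.fst.comp (Primrec.snd.comp Primrec.fst)))
      (Primrec.snd.comp (Primrec.snd.comp Primrec.fst))) (Primrec.const 0) (Primrec.const 1)
  have hP : Partrec fun a : ℕ × ℕ × List ℕ => (B a.1).map fun r =>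
      if Fits p r (coeffBound a.1) (tuple a.2.1) a.2.2 then 0 else 1 :=
    (hB.comp Computable.fst).map hfits.to_comp.to₂
  have hQ : Partrec₂ fun (c w : ℕ) => (B c).bind fun r => F (r, tuple w) c :=
    (hB.comp Computable.fst).bind (hF.comp (Computable.snd.pair
      (htuple.to_comp.comp (Computable.snd.comp Computable.fst)))
      (Computable.fst.comp Computable.fst)).to₂
  obtain ⟨Φ, hΦ⟩ := OracleCode.exists_search
    (P := fun c w s => (B c).map fun r => if Fits p r (coeffBound c) (tuple w) s then 0 else 1)
    (Q := fun c w => (B c).bind fun r => F (r, tuple w) c) hP hQ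
  refine ⟨Φ, fun n α X D hD => ?_⟩
  have hr : freeBound α ≤ n := freeBound_le α
  have hval : Φ.eval (tupleOracle X D) (formulaCode α) =
      Part.some (if α.Realize X then 1 else 0) := by
    refine hΦ _ _ _ (fun w => by rw [hBφ]; trivial) ?_ fun w hw => ?_
    · obtain ⟨l, hl⟩ := exists_eventually_fits hD hr (coeffBound (formulaCode α))
      obtain ⟨W, hW⟩ := Filter.eventually_atTop.1 hl
      -- The second component pads the candidate so that the segment of that length is long enough
      -- to accept `l`.
      refine ⟨Nat.pair (encode l) W, ?_⟩
      have := hW (Nat.pair (encode l) W) (Nat.right_le_pair _ _)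
      rw [hBφ, Part.map_some, Part.mem_some_iff]
      simp only [tuple, Nat.unpair_pair, Denumerable.ofNat_encode]
      rw [if_pos this]
    · rw [hBφ, Part.map_some, Part.mem_some_iff] at hw
      have hfit : Fits p (freeBound α) (coeffBound (formulaCode α)) (tuple w)
          (segment (tupleOracle X D) w) := by
        by_contra h
        rw [if_neg h] at hw
        exact zero_ne_one hw
      rw [hBφ, Part.bind_some]
      have hlists : Lists (freeBound α) (padicTuple X) (padicEquiv p ∘ X)
          (default : Fin 0 → ℤ_[p]) :=
        ⟨fun i _ => dif_pos i.2, fun j => j.elim0⟩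
      rw [hFφ α (tuple w) (padicTuple X) (padicEquiv p ∘ X) default le_rfl hfit.1 hlists
        (sim_of_fits hD hr hfit)]
      refine congrArg Part.some (if_congr ?_ rfl rfl)
      rw [← StrongHomClass.realize_formula (padicEquiv p) α, Formula.Realize]
      exact iff_of_eq (congrArg _ (Subsingleton.elim _ _))
  refine ⟨fun h => ?_, fun h => ?_⟩
  · exact hval.trans (by rw [if_pos h])
  · exact hval.trans (by rw [if_neg h])

end TreePres

theorem mainTheorem1 (p : ℕ) [Fact p.Prime] :
    TreePres.IsComputableTreePresentation TreePres.addGroupLang (TreePres.ZpTree p) ∧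
      Nonempty (TreePres.addGroupLang.Equiv (TreePres.ZpPaths p) ℤ_[p]) ∧
      TreePres.IsTreeDecidable TreePres.addGroupLang (TreePres.ZpTree p) :=
  ⟨TreePres.isComputableTreePresentation_ZpTree p, ⟨TreePres.padicEquiv p⟩,
    TreePres.isTreeDecidable_ZpTree p⟩
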